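/- Let $\gamma\ge 2$ be an integer, $\sigma>0$, and let $W=(W(x))_{x\ge 0}$ be a Brownian motion started at $0$ with diffusion constant $\sigma$ (i.e. continuous paths and $\operatorname{Var} W(x)=\sigma^2x$). Let $t>1$. For $m\ge 0$ let $r(t,m)$ be the smallest $x>m$, and $l(t,m)$ the largest $x\in[0,m)$, with $W(x)\ge W(m)+\ln t$, when they exist. The first $t$-stable point $m^*$ to the right of the origin is the smallest $m\ge0$ with $W(m)=\min_{[0,r(t,m)]}W$; a point $m>m^*$ is $t$-stable if $l=l(t,m)$ and $r=r(t,m)$ exist and $W(m)=\min_{[l,r]}W$. Let $\hat m_1(t)<\dots<\hat m_\gamma(t)$ be the first $\gamma$ $t$-stable points (including $\hat m_1(t)=m^*$), let $\hat h_i(t)=\arg\max_{x\in(\hat m_i(t),\hat m_{i+1}(t))}W(x)$ for $1\le i\le\gamma-1$ (all these points exist almost surely), and set $$\zeta_\gamma(t)=\sum_{i=1}^{\gamma-1}(\gamma-i)\,\frac{W(\hat h_i(t))-W(\hat m_i(t))}{\ln t}.$$ Then the law of $\zeta_\gamma(t)$ does not depend on $t>1$. Moreover, for each $t>1$, the random variable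 $\zeta_\gamma(t)-\frac{\gamma(\gamma-1)}{2}$ has the density equal to $$f_\gamma(x)=\sum_{i=1}^{\gamma-1}\frac{(-1)^{\gamma-1-i}\,i^{\gamma-2}}{i!\,(\gamma-1-i)!}\,e^{-x/i}\quad\text{for }x\ge 0,$$ and to $0$ for $x<0$ (where $f_\gamma\ge0$ on $[0,\infty)$), and it is almost surely equal to a sum $E_1+\dots+E_{\gamma-1}$ of independent random variables, where $E_i$ is exponentially distributed with mean $\gamma-i$. -/

import Mathlib

open MeasureTheory ProbabilityTheory
open scoped NNReal ENNReal

noncomputable section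

/-- `r = r(t,m)` is the smallest `x > m` such that `w x ≥ w m + ln t`. -/
def IsRightPoint (w : ℝ≥0 → ℝ) (t : ℝ) (m r : ℝ≥0) : Prop :=
  IsLeast {x | m < x ∧ w m + Real.log t ≤ w x} r

/-- `l = l(t,m)` is the largest `x < m` such that `w x ≥ w m + ln t`. -/
def IsLeftPoint (w : ℝ≥0 → ℝ) (t : ℝ) (m l : ℝ≥0) : Prop :=
  IsGreatest {x | x < m ∧ w m + Real.log t ≤ w x} l

/-- `m` is the first `t`-stable point of `w` to the right of the origin: the smallest `m` such that
`r = r(t,m)` exists and `w m = min_{[0,r]} w`. -/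
def IsFirstStablePoint (w : ℝ≥0 → ℝ) (t : ℝ) (m : ℝ≥0) : Prop :=
  IsLeast {x | ∃ r, IsRightPoint w t x r ∧ IsMinOn w (Set.Icc 0 r) x} m

/-- `m` is a `t`-stable point of `w`: either the first one to the right of the origin, or a point
to the right of the first one such that `l = l(t,m)` and `r = r(t,m)` exist and
`w m = min_{[l,r]} w`. -/
def IsStablePoint (w : ℝ≥0 → ℝ) (t : ℝ) (m : ℝ≥0) : Prop :=
  IsFirstStablePoint w t m ∨
    ∃ m₀, IsFirstStablePoint w t m₀ ∧ m₀ < m ∧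
      ∃ l r, IsLeftPoint w t m l ∧ IsRightPoint w t m r ∧ IsMinOn w (Set.Icc l r) m

/-- The successive `t`-stable points of `w`, in increasing order. The numbering starts from `0`:
`stablePoint w t i` is the `(i+1)`-st `t`-stable point to the right of the origin. -/
def stablePoint (w : ℝ≥0 → ℝ) (t : ℝ) : ℕ → ℝ≥0
  | 0 => sInf {m | IsStablePoint w t m}
  | i + 1 => sInf {m | IsStablePoint w t m ∧ stablePoint w t i < m}

/-- `h` is a point where `w` attains its maximum over the open interval between the `(i+1)`-st and
the `(i+2)`-nd `t`-stable points. -/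
def IsPeak (w : ℝ≥0 → ℝ) (t : ℝ) (i : ℕ) (h : ℝ≥0) : Prop :=
  h ∈ Set.Ioo (stablePoint w t i) (stablePoint w t (i + 1)) ∧
    IsMaxOn w (Set.Ioo (stablePoint w t i) (stablePoint w t (i + 1))) h

/-- The argmax of `w` between the `(i+1)`-st and the `(i+2)`-nd `t`-stable points. (The value of
`w` there does not depend on which maximizer is chosen.) -/
def peak (w : ℝ≥0 → ℝ) (t : ℝ) (i : ℕ) : ℝ≥0 :=
  Classical.epsilon (IsPeak w t i)

/-- The functional `ζ_γ(t)` of the path `w`. With the numbering from `0`, the weight of the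
`(i+1)`-st increment is `γ - (i+1)`. -/
def zeta (γ : ℕ) (w : ℝ≥0 → ℝ) (t : ℝ) : ℝ :=
  ∑ i ∈ Finset.range (γ - 1),
    ((γ : ℝ) - (i + 1)) * ((w (peak w t i) - w (stablePoint w t i)) / Real.log t)

/-- The function `f_γ`, as a formula (used for `x ≥ 0` and `γ ≥ 2`). -/
def fGamma (γ : ℕ) (x : ℝ) : ℝ :=
  ∑ i ∈ Finset.Icc 1 (γ - 1),
    (-1 : ℝ) ^ (γ - 1 - i) * (i : ℝ) ^ (γ - 2) /
      ((Nat.factorial i : ℝ) * (Nat.factorial (γ - 1 - i) : ℝ)) * Real.exp (-x / (i : ℝ))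

/-- `W` is a Brownian motion (started at `0`, with almost surely continuous paths) with diffusion
constant `σ`, i.e. `Var (W x) = σ² x`: it is `σ` times a standard Brownian motion. -/
def IsBrownianWithDiffusion {Ω : Type*} [MeasurableSpace Ω] (σ : ℝ) (W : ℝ≥0 → Ω → ℝ)
    (P : Measure Ω) : Prop :=
  ∃ B : ℝ≥0 → Ω → ℝ, IsBrownianReal B P ∧ ∀ x ω, W x ω = σ * B x ω

end

/-! Dividing the path by `ln t` turns the threshold into 1 and affects only the diffusion constant,
which plays no role in the final laws. The rescaled path is cut into alternating phases: an even
phase ends when the path has risen 1 above its running minimum, an odd phase when it has fallen 1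
below its running maximum. For a generic path, the extremum of phase `2i` is the stable point number
`i` (counted from 0) and the extremum of phase `2i+1` is the peak that follows it. The height of
that peak above that stable point is 1 plus the gain of phase `2i+1`, i.e. the distance from the
starting value of the phase to its maximum. The ones contribute `γ(γ-1)/2` to `ζ_γ`, and what
remains is a weighted sum of gains (`stablePoint_eq`, `isPeak_odd`, `peak_sub_stablePoint`).

The gains are independent exponentials of mean 1. Instead of the strong Markov property and
excursion theory, the proof uses an Azéma–Yor martingale: with gain `e` and drawdown `d` in the
current phase, `exp(Iθe)(1 - Iθd)` is a martingale. It starts at 1 and equals `exp(Iθe)(1 - Iθ)`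
when `d` reaches 1. The product over successive phases gives `∏ (1 - Iθ_j) · E exp(I Σ θ_j g_j) = 1`
(`IsPhaseGains.integral_exp`), which is the joint characteristic function required.

To avoid stochastic calculus, a discrete automaton reads the path on a grid. Its martingale differs
from a discrete stochastic integral by an error that vanishes with the mesh
(`tendsto_phaseMart_sub_integral`), the integral is centered and bounded in `L²`
(`phaseIntegral_moments`), and the gains of the automaton converge to those of the path
(`IsSkeleton.tendsto_phaseRun`). The convergence needs generic paths, and `ae_isGenericPath` shows
that almost every Brownian path is generic. Finally `f_γ` is identified by its characteristic
function, through partial fractions (`sum_hypoCoeff_div`). -/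

open Filter Topology Set

/-! ### Deterministic paths: phases, stable points and peaks. -/

/-- A path without coincidences between its local extrema, which has rises and falls of size `1`
after any given time. -/
structure IsGenericPath (w : ℝ≥0 → ℝ) : Prop where
  cont : Continuous w
  localMin_ne : ∀ m m', m < m' → IsLocalMin w m → IsLocalMin w m' → w m ≠ w m'
  localMax_ne : ∀ m h, IsLocalMin w m → IsLocalMax w h → w h ≠ w m + 1
  rise : ∀ a, ∃ y z, a ≤ y ∧ y ≤ z ∧ w y + 1 ≤ w z
  fall : ∀ a, ∃ y z, a ≤ y ∧ y ≤ z ∧ w z + 1 ≤ w y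

/-- Starting from the time `a`, the path `v` first falls by `1` below its running maximum at the
time `b`, and the maximum in between is attained at `h`. -/
structure IsPhase (v : ℝ≥0 → ℝ) (a h b : ℝ≥0) : Prop where
  le : a ≤ h
  lt : h < b
  le_max : ∀ x, a ≤ x → x ≤ b → v x ≤ v h
  drop : v h = v b + 1
  before : ∀ x y, a ≤ x → x ≤ y → y < b → v x < v y + 1

/-- Falls of size at least 1 inside `[a, z₀]` form a compact set of pairs, so one of them ends
earliest, at `b`. With `h` a maximizer on `[a, b]`, letting `x` increase to `b` in `v h < v x + 1`
shows that the drop is exactly 1. -/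
lemma exists_isPhase {v : ℝ≥0 → ℝ} (hv : Continuous v) {a : ℝ≥0}
    (ha : ∃ y z, a ≤ y ∧ y ≤ z ∧ v z + 1 ≤ v y) : ∃ h b, IsPhase v a h b := by
  obtain ⟨y₀, z₀, hy₀, hyz₀, hv₀⟩ := ha
  let K : Set (ℝ≥0 × ℝ≥0) := (Icc a z₀ ×ˢ Icc a z₀) ∩ {q | q.1 ≤ q.2 ∧ v q.2 + 1 ≤ v q.1}
  have hK : IsCompact K := by
    refine (isCompact_Icc.prod isCompact_Icc).inter_right ?_
    exact (isClosed_le continuous_fst continuous_snd).inter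
      (isClosed_le ((hv.comp continuous_snd).add continuous_const) (hv.comp continuous_fst))
  have hne : K.Nonempty := ⟨(y₀, z₀), ⟨⟨hy₀, hyz₀⟩, ⟨hy₀.trans hyz₀, le_rfl⟩⟩, hyz₀, hv₀⟩
  obtain ⟨⟨y, b⟩, ⟨⟨⟨hay, -⟩, ⟨hab, hbz⟩⟩, hyb, hvyb⟩, hmin⟩ :=
    hK.exists_isMinOn hne continuous_snd.continuousOn
  simp only at hay hab hbz hyb hvyb
  have before : ∀ x y, a ≤ x → x ≤ y → y < b → v x < v y + 1 := by
    intro x y hx hxy hyb'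
    by_contra! hcon
    have := hmin (show (x, y) ∈ K from ⟨⟨⟨hx, (hxy.trans hyb'.le).trans hbz⟩,
      ⟨hx.trans hxy, hyb'.le.trans hbz⟩⟩, hxy, hcon⟩)
    exact absurd this (not_le.2 hyb')
  obtain ⟨h, ⟨hah, hhb⟩, hmax⟩ := isCompact_Icc.exists_isMaxOn (nonempty_Icc.2 hab) hv.continuousOn
  have hmax' : ∀ x, a ≤ x → x ≤ b → v x ≤ v h := fun x h1 h2 ↦ hmax ⟨h1, h2⟩
  have hvh : v b + 1 ≤ v h := hvyb.trans (hmax' y hay hyb)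
  have hlt : h < b := lt_of_le_of_ne hhb (by rintro rfl; linarith)
  refine ⟨h, b, hah, hlt, hmax', le_antisymm ?_ hvh, before⟩
  have htend : Tendsto (fun x ↦ v x + 1) (𝓝[<] b) (𝓝 (v b + 1)) :=
    ((hv.add continuous_const).tendsto b).mono_left nhdsWithin_le_nhds
  have : (𝓝[<] b).NeBot := nhdsLT_neBot_of_exists_lt ⟨h, hlt⟩
  refine ge_of_tendsto htend ?_
  filter_upwards [Ioo_mem_nhdsLT hlt] with x hx
  exact (before h x hah hx.1.le hx.2).le

/-- The hypothesis on `a` excludes a maximum at the left end, except at the origin, where `[0, b)`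
is already a neighbourhood in `ℝ≥0`. -/
lemma IsPhase.isLocalMax {v : ℝ≥0 → ℝ} {a h b : ℝ≥0} (H : IsPhase v a h b)
    (ha : a = 0 ∨ ∃ᶠ x in 𝓝[>] a, v a < v x) : IsLocalMax v h := by
  rcases H.le.eq_or_lt with rfl | hlt
  · rcases ha with rfl | ha
    · filter_upwards [Iio_mem_nhds H.lt] with x hx
      exact H.le_max x (zero_le) (le_of_lt hx)
    · obtain ⟨x, hx, hx'⟩ := (ha.and_eventually (Ioo_mem_nhdsGT H.lt)).exists
      exact absurd (H.le_max x hx'.1.le hx'.2.le) (not_le.2 hx)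
  · filter_upwards [Ioo_mem_nhds hlt H.lt] with x hx
    exact H.le_max x hx.1.le hx.2.le

/-- Otherwise `b` would be a local minimum exactly 1 below the local maximum `h`. This strict
overshoot is what makes the end of a phase visible on fine grids. -/
lemma IsPhase.frequently_lt {v : ℝ≥0 → ℝ} {a h b : ℝ≥0} (H : IsPhase v a h b)
    (hmax : IsLocalMax v h) (hne : ∀ m h, IsLocalMin v m → IsLocalMax v h → v h ≠ v m + 1) :
    ∃ᶠ x in 𝓝[>] b, v x < v b := by
  intro hcon
  refine hne b h ?_ hmax H.drop
  rw [eventually_nhdsWithin_iff] at hcon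
  filter_upwards [hcon, Ioi_mem_nhds H.lt] with x hx hx'
  rcases lt_trichotomy x b with h1 | rfl | h1
  · have := H.before h x H.le (le_of_lt hx') h1
    have := H.drop
    linarith
  · exact le_rfl
  · exact not_lt.1 (hx h1)

/-- The sign with which the path is read in phase `p`: in even phases one waits for a rise. -/
noncomputable def phaseSign (p : ℕ) : ℝ := (-1) ^ (p + 1)

lemma phaseSign_succ (p : ℕ) : phaseSign (p + 1) = -phaseSign p := by
  simp [phaseSign, pow_succ]

lemma phaseSign_even (i : ℕ) : phaseSign (2 * i) = -1 := by
  simp [phaseSign, pow_succ, pow_mul]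

lemma phaseSign_odd (i : ℕ) : phaseSign (2 * i + 1) = 1 := by
  simp [phaseSign_succ, phaseSign_even]

lemma phaseSign_eq (p : ℕ) : phaseSign p = 1 ∨ phaseSign p = -1 := by
  rcases Nat.even_or_odd' p with ⟨i, rfl | rfl⟩
  · exact Or.inr (phaseSign_even i)
  · exact Or.inl (phaseSign_odd i)

lemma abs_phaseSign (p : ℕ) : |phaseSign p| = 1 := by
  rcases phaseSign_eq p with h | h <;> simp [h]

/-- The successive alternating phases of a path: `τ p` is the beginning of phase `p`, and `h p` is
the extremum of the path during this phase. -/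
structure IsSkeleton (w : ℝ≥0 → ℝ) (τ h : ℕ → ℝ≥0) : Prop where
  zero : τ 0 = 0
  phase : ∀ p, IsPhase (fun x ↦ phaseSign p * w x) (τ p) (h p) (τ (p + 1))

lemma IsGenericPath.exists_isSkeleton {w : ℝ≥0 → ℝ} (hw : IsGenericPath w) :
    ∃ τ h, IsSkeleton w τ h := by
  have key : ∀ (p : ℕ) (a : ℝ≥0), ∃ q : ℝ≥0 × ℝ≥0,
      IsPhase (fun x ↦ phaseSign p * w x) a q.1 q.2 := by
    intro p a
    have hc := hw.cont
    obtain ⟨h, b, H⟩ := exists_isPhase (v := fun x ↦ phaseSign p * w x) (a := a) (by fun_prop) (by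
      rcases phaseSign_eq p with h | h
      · simpa [h] using hw.fall a
      · obtain ⟨y, z, h1, h2, h3⟩ := hw.rise a
        exact ⟨y, z, h1, h2, by rw [h]; linarith⟩)
    exact ⟨(h, b), H⟩
  choose F hF using key
  let τ : ℕ → ℝ≥0 := fun n ↦ Nat.rec 0 (fun p a ↦ (F p a).2) n
  exact ⟨τ, fun p ↦ (F p (τ p)).1, rfl, fun p ↦ hF p (τ p)⟩

lemma IsGenericPath.phase_ne {w : ℝ≥0 → ℝ} (hw : IsGenericPath w) (p : ℕ) (m h : ℝ≥0)
    (hm : IsLocalMin (fun x ↦ phaseSign p * w x) m)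
    (hh : IsLocalMax (fun x ↦ phaseSign p * w x) h) :
    phaseSign p * w h ≠ phaseSign p * w m + 1 := by
  rcases phaseSign_eq p with hp | hp
  · simp only [hp, one_mul] at *
    exact hw.localMax_ne m h hm hh
  · simp only [hp, neg_mul, one_mul] at *
    have h1 : IsLocalMin w h := by simpa using hh.neg
    have h2 : IsLocalMax w m := by simpa using hm.neg
    have := hw.localMax_ne h m h1 h2
    contrapose! this
    linarith

/-- The two claims sustain each other: the overshoot at the end of a phase keeps the next extremum
away from the start of its phase, so that it is a local extremum, and genericity then forces the
next overshoot. -/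
lemma IsSkeleton.isLocalMax_and {w : ℝ≥0 → ℝ} {τ h : ℕ → ℝ≥0} (H : IsSkeleton w τ h)
    (hw : IsGenericPath w) (p : ℕ) :
    IsLocalMax (fun x ↦ phaseSign p * w x) (h p) ∧
    ∃ᶠ x in 𝓝[>] (τ (p + 1)), phaseSign p * w x < phaseSign p * w (τ (p + 1)) := by
  induction p with
  | zero =>
    have h1 := (H.phase 0).isLocalMax (Or.inl H.zero)
    exact ⟨h1, (H.phase 0).frequently_lt h1 (hw.phase_ne 0)⟩
  | succ p ih =>
    have h1 := (H.phase (p + 1)).isLocalMax (Or.inr (by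
      simpa only [phaseSign_succ, neg_mul, neg_lt_neg_iff] using ih.2))
    exact ⟨h1, (H.phase (p + 1)).frequently_lt h1 (hw.phase_ne (p + 1))⟩

namespace IsSkeleton

variable {w : ℝ≥0 → ℝ} {τ h : ℕ → ℝ≥0}

/-- The right point is `τ 1`. An earlier candidate would have its right point beyond `τ 1`, hence
would tie with `h 0`, and two local minima of a generic path have different values. -/
lemma isFirstStablePoint (H : IsSkeleton w τ h) (hw : IsGenericPath w) :
    IsFirstStablePoint w (Real.exp 1) (h 0) := by
  have P := H.phase 0
  have hs : phaseSign 0 = -1 := phaseSign_even 0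
  have h0 := H.zero
  have h2 := P.le_max; have h3 := P.drop; have h4 := P.before; have hlt := P.lt
  simp only [hs, h0, zero_add, zero_le, true_imp_iff] at h2 h3 h4 hlt
  refine ⟨⟨τ 1, ⟨⟨hlt, ?_⟩, ?_⟩, ?_⟩, ?_⟩
  · rw [Real.log_exp]; linarith
  · rintro x ⟨hx1, hx2⟩
    rw [Real.log_exp] at hx2
    by_contra! hcon
    have := h4 (h 0) x hx1.le hcon
    linarith
  · intro x hx
    have := h2 x hx.2
    simp only [mem_ofPred_eq]
    linarith
  · rintro x ⟨r, ⟨⟨hr1, hr2⟩, -⟩, hr4⟩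
    rw [Real.log_exp] at hr2
    have hr : τ 1 ≤ r := by
      by_contra! hcon
      have := h4 x r hr1.le hcon
      linarith
    by_contra! hcon
    have e1 : w x ≤ w (h 0) := hr4 ⟨zero_le, (hlt.le).trans hr⟩
    have e2 := h2 x (hcon.trans hlt).le
    have hmin : IsLocalMin w x := by
      filter_upwards [Iio_mem_nhds (hcon.trans hlt)] with y hy
      have := h2 y (le_of_lt hy)
      linarith
    have hmin0 : IsLocalMin w (h 0) := by
      filter_upwards [Iio_mem_nhds hlt] with y hy
      have := h2 y (le_of_lt hy)
      linarith
    exact hw.localMin_ne _ _ hcon hmin hmin0 (by linarith)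

lemma isLocalMin_even (H : IsSkeleton w τ h) (hw : IsGenericPath w) (i : ℕ) :
    IsLocalMin w (h (2 * i)) := by
  have := (H.isLocalMax_and hw (2 * i)).1
  simp only [phaseSign_even, neg_mul, one_mul] at this
  simpa using this.neg

lemma lt_succ_succ (H : IsSkeleton w τ h) (p : ℕ) : h p < h (p + 1) :=
  (H.phase p).lt.trans_le (H.phase (p + 1)).le

lemma strictMono (H : IsSkeleton w τ h) : StrictMono h :=
  strictMono_nat_of_lt_succ H.lt_succ_succ

/-- The peak `k` of the preceding phase is at least 1 above `m`, so the left point lies in `[k, m)`.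
From `k` to the end `a` of that phase the path stays above `w k - 1 = w a ≥ w m`, and from `a` on
`m` is the minimum by construction. -/
lemma isStablePoint_even (H : IsSkeleton w τ h) (hw : IsGenericPath w) (i : ℕ) :
    IsStablePoint w (Real.exp 1) (h (2 * i)) := by
  rcases Nat.eq_zero_or_pos i with rfl | hi
  · exact Or.inl (H.isFirstStablePoint hw)
  refine Or.inr ⟨h 0, H.isFirstStablePoint hw, H.strictMono (by omega), ?_⟩
  obtain ⟨j, rfl⟩ : ∃ j, i = j + 1 := ⟨i - 1, by omega⟩
  have P := H.phase (2 * (j + 1))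
  have Q := H.phase (2 * j + 1)
  rw [show 2 * j + 1 + 1 = 2 * (j + 1) by ring] at Q
  have hlt := P.lt
  have hle := P.le
  have p2 := P.le_max; have p3 := P.drop; have p4 := P.before
  have q1 := Q.lt; have q2 := Q.le_max; have q3 := Q.drop; have q4 := Q.before
  have q5 := Q.le
  simp only [phaseSign_even, phaseSign_odd] at p2 p3 p4 q2 q3 q4
  set m := h (2 * (j + 1))
  set a := τ (2 * (j + 1))
  set k := h (2 * j + 1)
  have hkm : k < m := q1.trans_le hle
  have hma : w m ≤ w a := by have := p2 a le_rfl (hle.trans hlt.le); linarith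
  have hwc := hw.cont
  -- The point `m` itself fails the height condition, so `x < m` may be relaxed to `x ≤ m`; the set
  -- is then compact and has a largest element.
  have hset : {x | x < m ∧ w m + Real.log (Real.exp 1) ≤ w x} =
      Icc 0 m ∩ {x | w m + Real.log (Real.exp 1) ≤ w x} := by
    ext x
    simp only [Real.log_exp, mem_ofPred_eq, mem_inter_iff, mem_Icc, zero_le, true_and]
    refine ⟨fun hx ↦ ⟨hx.1.le, hx.2⟩, fun hx ↦ ⟨lt_of_le_of_ne hx.1 ?_, hx.2⟩⟩
    rintro rfl
    linarith [hx.2]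
  have hcomp : IsCompact {x | x < m ∧ w m + Real.log (Real.exp 1) ≤ w x} := by
    rw [hset]
    exact isCompact_Icc.inter_right (isClosed_le continuous_const hwc)
  have hkmem : k ∈ {x | x < m ∧ w m + Real.log (Real.exp 1) ≤ w x} := by
    refine ⟨hkm, ?_⟩
    rw [Real.log_exp]; linarith
  obtain ⟨l, hl⟩ := hcomp.exists_isGreatest ⟨k, hkmem⟩
  refine ⟨l, τ (2 * (j + 1) + 1), hl, ⟨⟨hlt, ?_⟩, ?_⟩, ?_⟩
  · rw [Real.log_exp]; linarith
  · rintro x ⟨hx1, hx2⟩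
    rw [Real.log_exp] at hx2
    by_contra! hcon
    have := p4 m x hle hx1.le hcon
    linarith
  · rintro x ⟨hx1, hx2⟩
    have hkl := hl.2 hkmem
    simp only [mem_ofPred_eq]
    rcases lt_or_ge x a with hxa | hxa
    · have := q4 k x q5 (hkl.trans hx1) hxa
      linarith
    · have := p2 x hxa hx2
      linarith

/-- The cases follow the phase containing `m`. In an even phase, the window `[l, r]` would contain
the stable point of that phase, giving two local minima of equal value. In an odd phase, the absence
of a fall by 1 before `m` puts `l` before that phase, where either position of `l` relative to `a`
contradicts the levels reached. The overshoot handles the boundary point `m = t2`. -/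
lemma not_isStablePoint (H : IsSkeleton w τ h) (hw : IsGenericPath w) (i : ℕ) {m : ℝ≥0}
    (h1 : h (2 * i) < m) (h2 : m < h (2 * (i + 1))) : ¬ IsStablePoint w (Real.exp 1) m := by
  rintro (hm | ⟨-, -, -, l, r, ⟨⟨hl1, hl2⟩, -⟩, ⟨⟨hr1, hr2⟩, -⟩, hmin⟩)
  · have := (H.isFirstStablePoint hw).unique hm
    have := H.strictMono.monotone (Nat.zero_le (2 * i))
    order
  rw [Real.log_exp] at hl2 hr2
  have A := H.phase (2 * i)
  have B := H.phase (2 * i + 1)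
  have C := H.phase (2 * (i + 1))
  have hloc := H.isLocalMin_even hw i
  have hloc' := H.isLocalMin_even hw (i + 1)
  have hover := (H.isLocalMax_and hw (2 * i + 1)).2
  rw [show 2 * i + 1 + 1 = 2 * (i + 1) by ring] at B hover
  have a1 := A.lt; have a2 := A.le_max; have a3 := A.drop; have a4 := A.before; have a5 := A.le
  have b1 := B.lt; have b2 := B.le_max; have b3 := B.drop; have b4 := B.before; have b5 := B.le
  have c1 := C.lt; have c2 := C.le_max; have c3 := C.drop; have c4 := C.before; have c5 := C.le
  simp only [phaseSign_even, phaseSign_odd, one_mul] at a2 a3 a4 b2 b3 b4 c2 c3 c4 hover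
  set a := h (2 * i)
  set b := h (2 * i + 1)
  set c := h (2 * (i + 1))
  set t0 := τ (2 * i)
  set t1 := τ (2 * i + 1)
  set t2 := τ (2 * (i + 1))
  set t3 := τ (2 * (i + 1) + 1)
  rcases le_or_gt m t1 with hm1 | hm1
  · have e1 : w a ≤ w m := by have := a2 m (by order) hm1; linarith
    have hla : l < a := by
      by_contra! hcon
      have := a4 a l a5 hcon (by order)
      linarith
    have e2 : w m ≤ w a := hmin ⟨hla.le, by order⟩
    have hm2 : m < t1 := lt_of_le_of_ne hm1 (by rintro rfl; linarith)
    refine hw.localMin_ne a m h1 hloc ?_ (by linarith)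
    filter_upwards [Ioo_mem_nhds h1 hm2] with x hx
    have := a2 x (by have := hx.1; order) hx.2.le
    linarith
  rcases lt_or_ge m t2 with hm2 | hm2
  · have hlt1 : l < t1 := by
      by_contra! hcon
      have := b4 l m hcon hl1.le hm2
      linarith
    rcases lt_or_ge l a with hla | hla
    · have e1 : w m ≤ w a := hmin ⟨hla.le, by order⟩
      have := b4 t1 m le_rfl hm1.le hm2
      linarith
    · have e1 := a4 a l a5 hla hlt1
      have e2 := b4 t1 m le_rfl hm1.le hm2
      have e3 := a2 l (by order) hlt1.le
      have e4 := hmin (show t1 ∈ Icc l r from ⟨hlt1.le, by order⟩)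
      have e5 := a4 a l
      linarith
  · have hr : t3 ≤ r := by
      by_contra! hcon
      have := c4 m r hm2 hr1.le hcon
      linarith
    have e1 : w m ≤ w c := hmin ⟨by order, by order⟩
    have e2 := c2 m hm2 (by order)
    have hm3 : t2 < m := by
      refine lt_of_le_of_ne hm2 ?_
      intro heq
      obtain ⟨x, hx, hx'⟩ := (hover.and_eventually
        (Ioo_mem_nhdsGT (show t2 < t3 by order))).exists
      have := c2 x hx'.1.le hx'.2.le
      rw [← heq] at e1
      linarith
    refine hw.localMin_ne m c h2 ?_ hloc' (by linarith)
    filter_upwards [Ioo_mem_nhds hm3 h2] with x hx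
    have := c2 x hx.1.le (by have := hx.2; order)
    linarith

lemma stablePoint_eq (H : IsSkeleton w τ h) (hw : IsGenericPath w) (i : ℕ) :
    stablePoint w (Real.exp 1) i = h (2 * i) := by
  induction i with
  | zero =>
    refine IsLeast.csInf_eq ⟨H.isStablePoint_even hw 0, ?_⟩
    rintro m (hm | ⟨m₀, hm₀, hlt, -⟩)
    · exact ((H.isFirstStablePoint hw).unique hm).le
    · exact ((H.isFirstStablePoint hw).unique hm₀).le.trans hlt.le
  | succ i ih =>
    refine IsLeast.csInf_eq ⟨⟨H.isStablePoint_even hw (i + 1), ?_⟩, ?_⟩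
    · rw [ih]; exact H.strictMono (by omega)
    · rintro m ⟨hm, hlt⟩
      rw [ih] at hlt
      by_contra! hcon
      exact H.not_isStablePoint hw i hlt hcon hm

/-- Before the rising phase the path is below `w (τ (2 * i + 1))`, the level at which this phase
starts; after it, the path has not yet risen by 1 from the level `w (h (2 * i + 1)) - 1`. -/
lemma isPeak_odd (H : IsSkeleton w τ h) (hw : IsGenericPath w) (i : ℕ) :
    IsPeak w (Real.exp 1) i (h (2 * i + 1)) := by
  rw [IsPeak, H.stablePoint_eq hw, H.stablePoint_eq hw]
  refine ⟨⟨H.strictMono (by omega), H.strictMono (by omega)⟩, ?_⟩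
  have A := H.phase (2 * i)
  have B := H.phase (2 * i + 1)
  have C := H.phase (2 * (i + 1))
  rw [show 2 * i + 1 + 1 = 2 * (i + 1) by ring] at B
  have a1 := A.lt; have a2 := A.le_max; have a3 := A.drop; have a4 := A.before; have a5 := A.le
  have b1 := B.lt; have b2 := B.le_max; have b3 := B.drop; have b4 := B.before; have b5 := B.le
  have c1 := C.lt; have c2 := C.le_max; have c3 := C.drop; have c4 := C.before; have c5 := C.le
  simp only [phaseSign_even, phaseSign_odd, one_mul] at a2 a3 a4 b2 b3 b4 c2 c3 c4
  rintro x ⟨hx1, hx2⟩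
  simp only [mem_ofPred_eq]
  rcases lt_or_ge x (τ (2 * i + 1)) with h1 | h1
  · have := a4 _ x a5 hx1.le h1
    have := b2 _ le_rfl (b5.trans b1.le)
    linarith
  rcases le_or_gt x (τ (2 * (i + 1))) with h2 | h2
  · exact b2 x h1 h2
  · have := c4 _ x le_rfl h2.le (hx2.trans c1)
    linarith

lemma isPeak_peak (H : IsSkeleton w τ h) (hw : IsGenericPath w) (i : ℕ) :
    IsPeak w (Real.exp 1) i (peak w (Real.exp 1) i) :=
  Classical.epsilon_spec ⟨_, H.isPeak_odd hw i⟩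

lemma apply_peak (H : IsSkeleton w τ h) (hw : IsGenericPath w) (i : ℕ) :
    w (peak w (Real.exp 1) i) = w (h (2 * i + 1)) :=
  le_antisymm ((H.isPeak_odd hw i).2 (H.isPeak_peak hw i).1)
    ((H.isPeak_peak hw i).2 (H.isPeak_odd hw i).1)

/-- The height of a peak above the preceding stable point exceeds `1` by the gain of the
corresponding phase. -/
lemma peak_sub_stablePoint (H : IsSkeleton w τ h) (hw : IsGenericPath w) (i : ℕ) :
    w (peak w (Real.exp 1) i) - w (stablePoint w (Real.exp 1) i) - 1 =
      phaseSign (2 * i + 1) * (w (h (2 * i + 1)) - w (τ (2 * i + 1))) := by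
  have a3 := (H.phase (2 * i)).drop
  rw [H.apply_peak hw, H.stablePoint_eq hw, phaseSign_odd]
  simp only [phaseSign_even] at a3
  linarith

end IsSkeleton

/-! ### The phase automaton reading a sequence of increments. -/

/-- The state of the discrete phase automaton: the number of the current phase, the current
distance to the running maximum, and the gains of the running maximum in all the phases. -/
abbrev PhaseState := ℕ × ℝ × (ℕ → ℝ)

/-- One step of the phase automaton, when the path has the increment `ξ`. -/
noncomputable def phaseStep (ξ : ℝ) (s : PhaseState) : PhaseState :=
  if 1 ≤ s.2.1 - phaseSign s.1 * ξ then
    (s.1 + 1, 0, s.2.2)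
  else (s.1, max (s.2.1 - phaseSign s.1 * ξ) 0,
    fun i ↦ s.2.2 i + if i = s.1 then max (phaseSign s.1 * ξ - s.2.1) 0 else 0)

/-- The states of the phase automaton reading the increments `ξ`. -/
noncomputable def phaseRun (ξ : ℕ → ℝ) : ℕ → PhaseState
  | 0 => (0, 0, fun _ ↦ 0)
  | k + 1 => phaseStep (ξ k) (phaseRun ξ k)

lemma phaseStep_cases (ξ : ℝ) (s : PhaseState) :
    (s.2.1 < phaseSign s.1 * ξ ∧ phaseStep ξ s = (s.1, 0,
      fun i ↦ s.2.2 i + if i = s.1 then phaseSign s.1 * ξ - s.2.1 else 0)) ∨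
    (phaseSign s.1 * ξ ≤ s.2.1 ∧ s.2.1 - phaseSign s.1 * ξ < 1 ∧
      phaseStep ξ s = (s.1, s.2.1 - phaseSign s.1 * ξ, s.2.2)) ∨
    (1 ≤ s.2.1 - phaseSign s.1 * ξ ∧ phaseStep ξ s = (s.1 + 1, 0, s.2.2)) := by
  unfold phaseStep
  by_cases h1 : 1 ≤ s.2.1 - phaseSign s.1 * ξ
  · exact Or.inr (Or.inr ⟨h1, by rw [if_pos h1]⟩)
  · rw [if_neg h1]
    rcases lt_or_ge s.2.1 (phaseSign s.1 * ξ) with h2 | h2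
    · refine Or.inl ⟨h2, ?_⟩
      rw [max_eq_right (by linarith), max_eq_left (by linarith)]
    · refine Or.inr (Or.inl ⟨h2, not_le.1 h1, ?_⟩)
      rw [max_eq_left (by linarith), max_eq_right (by linarith)]
      simp

lemma phaseRun_invariant (ξ : ℕ → ℝ) (k : ℕ) :
    (0 ≤ (phaseRun ξ k).2.1 ∧ (phaseRun ξ k).2.1 < 1) ∧ (∀ i, 0 ≤ (phaseRun ξ k).2.2 i) ∧
      ∀ i, (phaseRun ξ k).1 < i → (phaseRun ξ k).2.2 i = 0 := by
  induction k with
  | zero => simp [phaseRun]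
  | succ k ih =>
    obtain ⟨⟨h0, h1⟩, h2, h3⟩ := ih
    rcases phaseStep_cases (ξ k) (phaseRun ξ k) with ⟨c1, c2⟩ | ⟨c1, c2, c3⟩ | ⟨c1, c2⟩
    · rw [phaseRun, c2]
      refine ⟨by simp, fun i ↦ ?_, fun i hi ↦ ?_⟩
      · have := h2 i
        dsimp only
        split_ifs <;> linarith
      · dsimp only at hi ⊢
        rw [h3 i hi, if_neg hi.ne']; simp
    · rw [phaseRun, c3]
      exact ⟨⟨by dsimp only; linarith, c2⟩, h2, h3⟩
    · rw [phaseRun, c2]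
      exact ⟨by simp, h2, fun i hi ↦ h3 i (by dsimp only at hi; omega)⟩

lemma phaseRun_frozen (ξ : ℕ → ℝ) {a k : ℕ} (hak : a ≤ k) :
    (phaseRun ξ a).1 ≤ (phaseRun ξ k).1 ∧
      ∀ i < (phaseRun ξ a).1, (phaseRun ξ k).2.2 i = (phaseRun ξ a).2.2 i := by
  induction k, hak using Nat.le_induction with
  | base => simp
  | succ k hk ih =>
    obtain ⟨h1, h2⟩ := ih
    rcases phaseStep_cases (ξ k) (phaseRun ξ k) with
      ⟨c1, c2⟩ | ⟨c1, c2, c3⟩ | ⟨c1, c2⟩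
    · rw [phaseRun, c2]
      refine ⟨h1, fun i hi ↦ ?_⟩
      dsimp only
      rw [if_neg (by omega), add_zero, h2 i hi]
    · rw [phaseRun, c3]
      exact ⟨h1, h2⟩
    · rw [phaseRun, c2]
      exact ⟨h1.trans (Nat.le_succ _), h2⟩

/-- The increments of a sequence. -/
def increments (y : ℕ → ℝ) (k : ℕ) : ℝ := y (k + 1) - y k

/-- The index `b` is where the current phase was entered: gain minus drawdown is the signed
displacement since then. Whenever the gain grows the drawdown is 0, so the gain is itself a
difference of two terms of `y`. -/
lemma phaseRun_gain_le (y : ℕ → ℝ) {K : ℝ} (N : ℕ)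
    (hK : ∀ i ≤ N, ∀ j ≤ N, |y i - y j| ≤ K) {k : ℕ} (hk : k ≤ N) :
    (∀ i, (phaseRun (increments y) k).2.2 i ≤ K) ∧
      ∃ b ≤ k, (phaseRun (increments y) k).2.2 (phaseRun (increments y) k).1 -
        (phaseRun (increments y) k).2.1 = phaseSign (phaseRun (increments y) k).1 * (y k - y b) := by
  induction k with
  | zero =>
    refine ⟨fun i ↦ ?_, 0, le_rfl, by simp [phaseRun]⟩
    simpa [phaseRun] using hK 0 (by omega) 0 (by omega)
  | succ k ih =>
    obtain ⟨h1, b, hb, h2⟩ := ih (by omega)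
    obtain ⟨⟨i0, i1⟩, i2, i3⟩ := phaseRun_invariant (increments y) k
    have hinc : increments y k = y (k + 1) - y k := rfl
    rcases phaseStep_cases (increments y k) (phaseRun (increments y) k) with
      ⟨c1, c2⟩ | ⟨c1, c2, c3⟩ | ⟨c1, c2⟩
    · rw [phaseRun, c2]
      refine ⟨fun i ↦ ?_, b, by omega, ?_⟩
      · dsimp only
        split_ifs with hi
        · subst hi
          have e1 : phaseSign (phaseRun (increments y) k).1 * (y (k + 1) - y b) ≤
              |y (k + 1) - y b| := by
            refine (le_abs_self _).trans ?_
            rw [abs_mul, abs_phaseSign, one_mul]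
          have e2 := hK (k + 1) hk b (by omega)
          rw [hinc]
          linarith
        · simpa using h1 i
      · simp only [if_true, sub_zero]
        rw [hinc]
        linarith
    · rw [phaseRun, c3]
      refine ⟨h1, b, by omega, ?_⟩
      dsimp only
      rw [hinc]
      linarith
    · rw [phaseRun, c2]
      refine ⟨h1, k + 1, le_rfl, ?_⟩
      dsimp only
      rw [i3 _ (Nat.lt_succ_self _)]
      simp

/-- The automaton has just entered phase `i`. -/
def IsEntry (s : PhaseState) (i : ℕ) : Prop :=
  s.1 = i ∧ s.2.1 = 0 ∧ ∀ j, i ≤ j → s.2.2 j = 0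

/-- The sequence `y`, multiplied by `c`, falls by at least `1` between the indices `a` and `b`. -/
def HasFall (c : ℝ) (y : ℕ → ℝ) (a b : ℕ) : Prop :=
  ∃ j j', a ≤ j ∧ j ≤ j' ∧ j' ≤ b ∧ 1 ≤ c * (y j - y j')

/-- Until a fall by 1 occurs, the recursion computes the running maximum of the signed sequence
since `a`: the drawdown is its distance to the current value and the gain its distance to the
starting value. -/
lemma phaseRun_of_not_hasFall {y : ℕ → ℝ} {a i k : ℕ}
    (ha : IsEntry (phaseRun (increments y) a) i) (hak : a ≤ k)
    (hf : ¬ HasFall (phaseSign i) y a k) :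
    (phaseRun (increments y) k).1 = i ∧
    (∀ j, a ≤ j → j ≤ k → phaseSign i * (y j - y k) ≤ (phaseRun (increments y) k).2.1) ∧
    (∃ j, a ≤ j ∧ j ≤ k ∧ (phaseRun (increments y) k).2.1 = phaseSign i * (y j - y k)) ∧
    (phaseRun (increments y) k).2.2 i =
      (phaseRun (increments y) k).2.1 + phaseSign i * (y k - y a) ∧
    ∀ j, j ≠ i → (phaseRun (increments y) k).2.2 j = (phaseRun (increments y) a).2.2 j := by
  induction k, hak using Nat.le_induction with
  | base =>
    refine ⟨ha.1, fun j h1 h2 ↦ ?_, ⟨a, le_rfl, le_rfl, ?_⟩, ?_, fun _ _ ↦ rfl⟩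
    · rw [le_antisymm h2 h1, ha.2.1]; simp
    · rw [ha.2.1]; simp
    · rw [ha.2.1, ha.2.2 i le_rfl]; simp
  | succ k hk ih =>
    obtain ⟨h1, h2, ⟨j, hj1, hj2, h3⟩, h4, h5⟩ := ih (fun ⟨j, j', q1, q2, q3, q4⟩ ↦
      hf ⟨j, j', q1, q2, by omega, q4⟩)
    obtain ⟨⟨i0, i1⟩, i2, i3⟩ := phaseRun_invariant (increments y) k
    have hinc : increments y k = y (k + 1) - y k := rfl
    rcases phaseStep_cases (increments y k) (phaseRun (increments y) k) with
      ⟨c1, c2⟩ | ⟨c1, c2, c3⟩ | ⟨c1, c2⟩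
    · rw [phaseRun, c2]
      rw [hinc, h1] at c1
      simp only [hinc, h1]
      refine ⟨trivial, fun l hl1 hl2 ↦ ?_, ⟨k + 1, by omega, le_rfl, by simp⟩, ?_, fun l hl ↦ ?_⟩
      · rcases Nat.lt_or_ge l (k + 1) with hl | hl
        · have := h2 l hl1 (by omega)
          linarith
        · rw [show l = k + 1 by omega]; simp
      · simp only [if_true]
        linarith
      · rw [if_neg hl, add_zero, h5 l hl]
    · rw [phaseRun, c3]
      rw [hinc, h1] at c1 c2
      simp only [hinc, h1]
      refine ⟨trivial, fun l hl1 hl2 ↦ ?_, ⟨j, hj1, by omega, by linarith⟩, by linarith, h5⟩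
      rcases Nat.lt_or_ge l (k + 1) with hl | hl
      · have := h2 l hl1 (by omega)
        linarith
      · rw [show l = k + 1 by omega]; simp only [sub_self, mul_zero]; linarith
    · rw [hinc, h1] at c1
      exact absurd ⟨j, k + 1, hj1, by omega, le_rfl, by linarith⟩ hf

/-- The next entry is the first index completing a fall by 1. This minimality is part of the
conclusion because it locates the entry in the limit of fine grids. -/
lemma exists_next_entry {y : ℕ → ℝ} {a i : ℕ}
    (ha : IsEntry (phaseRun (increments y) a) i) (hf : ∃ b, HasFall (phaseSign i) y a b) :
    ∃ a', a < a' ∧ IsEntry (phaseRun (increments y) a') (i + 1) ∧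
      (∀ j, j ≠ i → (phaseRun (increments y) a').2.2 j = (phaseRun (increments y) a).2.2 j) ∧
      (∃ j, a ≤ j ∧ j ≤ a' ∧
        (phaseRun (increments y) a').2.2 i = phaseSign i * (y j - y a)) ∧
      (∀ j, a ≤ j → j < a' →
        phaseSign i * (y j - y a) ≤ (phaseRun (increments y) a').2.2 i) ∧
      HasFall (phaseSign i) y a a' ∧ ∀ b, HasFall (phaseSign i) y a b → a' ≤ b := by
  classical
  obtain ⟨a', hf', hmin⟩ : ∃ a', HasFall (phaseSign i) y a a' ∧
      ∀ b, HasFall (phaseSign i) y a b → a' ≤ b :=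
    ⟨Nat.find hf, Nat.find_spec hf, fun b hb ↦ Nat.find_min' hf hb⟩
  obtain ⟨j, j', q1, q2, q3, q4⟩ := hf'
  have hne : j ≠ j' := by rintro rfl; norm_num at q4
  obtain ⟨k, rfl⟩ : ∃ k, a' = k + 1 := ⟨a' - 1, by omega⟩
  have hnot : ¬ HasFall (phaseSign i) y a k := fun hcon ↦ by have := hmin k hcon; omega
  have hj' : j' = k + 1 := by
    by_contra hcon
    exact hnot ⟨j, j', q1, q2, by omega, q4⟩
  subst hj'
  obtain ⟨h1, h2, ⟨l, hl1, hl2, h3⟩, h4, h5⟩ := phaseRun_of_not_hasFall ha (k := k) (by omega) hnot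
  obtain ⟨⟨i0, i1⟩, i2, i3⟩ := phaseRun_invariant (increments y) k
  have hinc : increments y k = y (k + 1) - y k := rfl
  have hj := h2 j q1 (by omega)
  have hstep : phaseRun (increments y) (k + 1) = (i + 1, 0, (phaseRun (increments y) k).2.2) := by
    rw [phaseRun, phaseStep, if_pos, h1]
    rw [h1, hinc]; linarith
  refine ⟨k + 1, by omega, ?_, ?_, ⟨l, hl1, by omega, ?_⟩, fun m hm1 hm2 ↦ ?_,
    ⟨j, k + 1, q1, q2, q3, q4⟩, hmin⟩
  · rw [hstep]
    exact ⟨rfl, rfl, fun m hm ↦ i3 m (by omega)⟩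
  · rw [hstep]; exact h5
  · rw [hstep]; dsimp only; linarith
  · rw [hstep]; dsimp only
    have := h2 m hm1 (by omega)
    linarith

/-! ### Convergence of the automaton on fine grids. -/

/-- The points of the grid of mesh `1 / (n + 1)`. -/
noncomputable def gridPoint (n k : ℕ) : ℝ≥0 := (k : ℝ≥0) / ((n : ℝ≥0) + 1)

lemma gridPoint_mono (n : ℕ) : Monotone (gridPoint n) := fun j k hjk ↦ by
  unfold gridPoint
  gcongr

lemma gridPoint_lt_iff {n j k : ℕ} : gridPoint n j < gridPoint n k ↔ j < k := by
  unfold gridPoint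
  rw [div_lt_div_iff_of_pos_right (by positivity)]
  exact Nat.cast_lt

lemma tendsto_gridPoint_ceil (x : ℝ≥0) :
    Tendsto (fun n : ℕ ↦ gridPoint n ⌈x * ((n : ℝ≥0) + 1)⌉₊) atTop (𝓝 x) := by
  have h := (tendsto_nat_ceil_mul_div_atTop (R := ℝ) (a := (x : ℝ)) x.2).comp
    ((tendsto_natCast_atTop_atTop (R := ℝ)).comp (tendsto_add_atTop_nat 1))
  rw [← NNReal.tendsto_coe]
  refine h.congr fun n ↦ ?_
  have : ⌈x * ((n : ℝ≥0) + 1)⌉₊ = ⌈(x : ℝ) * ((n : ℝ) + 1)⌉₊ := by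
    apply eq_of_forall_ge_iff
    intro c
    rw [Nat.ceil_le, Nat.ceil_le, ← NNReal.coe_le_coe]
    push_cast
    rfl
  simp [gridPoint, this]

/-- The samples of a path on the grid of mesh `1 / (n + 1)`. -/
noncomputable def samples (w : ℝ≥0 → ℝ) (n k : ℕ) : ℝ := w (gridPoint n k)

/-- A fall seen on the grid is a fall of the path, so the automaton never ends a phase early.
Conversely the path overshoots strictly just after `τ (i + 1)`, and a strict inequality survives
sampling, so it ends the phase soon after. -/
lemma IsSkeleton.exists_entries {w : ℝ≥0 → ℝ} {τ h : ℕ → ℝ≥0} (H : IsSkeleton w τ h)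
    (hw : IsGenericPath w) (i : ℕ) :
    ∃ a : ℕ → ℕ, Tendsto (fun n ↦ gridPoint n (a n)) atTop (𝓝 (τ i)) ∧
      (∀ᶠ n in atTop, τ i ≤ gridPoint n (a n) ∧
        IsEntry (phaseRun (increments (samples w n)) (a n)) i) ∧
      ∀ j < i, Tendsto (fun n ↦ (phaseRun (increments (samples w n)) (a n)).2.2 j) atTop
        (𝓝 (phaseSign j * (w (h j) - w (τ j)))) := by
  induction i with
  | zero =>
    refine ⟨fun _ ↦ 0, by simp [gridPoint, H.zero], Eventually.of_forall fun n ↦ ⟨?_, ?_⟩,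
      by simp⟩
    · simp [H.zero]
    · simp [IsEntry, phaseRun]
  | succ i ih =>
    obtain ⟨a, ha, hent, hgain⟩ := ih
    have P := H.phase i
    have hwc := hw.cont
    have hvc : Continuous (fun x ↦ phaseSign i * w x) := by fun_prop
    -- Rounding `h i` up may give an index before the entry `a n`; the maximum with `a n` repairs
    -- this, without changing the limit since `τ i ≤ h i`.
    let jn : ℕ → ℕ := fun n ↦ max (a n) ⌈h i * ((n : ℝ≥0) + 1)⌉₊
    have hjn : Tendsto (fun n ↦ gridPoint n (jn n)) atTop (𝓝 (h i)) := by
      have : ∀ n, gridPoint n (jn n) =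
          max (gridPoint n (a n)) (gridPoint n ⌈h i * ((n : ℝ≥0) + 1)⌉₊) :=
        fun n ↦ (gridPoint_mono n).map_max
      simp_rw [this]
      have h2 := ha.max (tendsto_gridPoint_ceil (h i))
      rwa [max_eq_right P.le] at h2
    have hajn : ∀ n, a n ≤ jn n := fun n ↦ le_max_left _ _
    -- falls of the samples slightly after the end of the phase
    have hfall : ∀ c, τ (i + 1) < c → ∀ᶠ n in atTop, ∃ b, gridPoint n b < c ∧
        HasFall (phaseSign i) (samples w n) (a n) b := by
      intro c hc
      obtain ⟨x, hx, hx1, hx2⟩ := ((H.isLocalMax_and hw i).2.and_eventually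
        (Ioo_mem_nhdsGT hc)).exists
      have hkn := tendsto_gridPoint_ceil x
      have hlim : Tendsto (fun n : ℕ ↦ phaseSign i * w (gridPoint n (jn n)) -
          phaseSign i * w (gridPoint n ⌈x * ((n : ℝ≥0) + 1)⌉₊)) atTop
          (𝓝 (phaseSign i * w (h i) - phaseSign i * w x)) :=
        ((hvc.tendsto _).comp hjn).sub ((hvc.tendsto _).comp hkn)
      have hgt : 1 < phaseSign i * w (h i) - phaseSign i * w x := by
        have := P.drop
        linarith
      have hhx : h i < x := P.lt.trans hx1
      obtain ⟨c', hc'1, hc'2⟩ := exists_between hhx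
      filter_upwards [hlim.eventually_const_lt hgt, hjn.eventually_lt_const hc'1,
        hkn.eventually_const_lt hc'2, hkn.eventually_lt_const hx2] with n e1 e2 e3 e4
      refine ⟨_, e4, jn n, _, hajn n, (gridPoint_lt_iff.1 (e2.trans e3)).le, le_rfl, ?_⟩
      simp only [samples]
      linarith
    have hex := (hfall (τ (i + 1) + 1) (by simp)).and hent
    have hex2 : ∀ᶠ n in atTop, ∃ a', a n < a' ∧
        IsEntry (phaseRun (increments (samples w n)) a') (i + 1) ∧
        (∀ j, j ≠ i → (phaseRun (increments (samples w n)) a').2.2 j =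
          (phaseRun (increments (samples w n)) (a n)).2.2 j) ∧
        (∃ j, a n ≤ j ∧ j ≤ a' ∧ (phaseRun (increments (samples w n)) a').2.2 i =
          phaseSign i * (samples w n j - samples w n (a n))) ∧
        (∀ j, a n ≤ j → j < a' → phaseSign i * (samples w n j - samples w n (a n)) ≤
          (phaseRun (increments (samples w n)) a').2.2 i) ∧
        HasFall (phaseSign i) (samples w n) (a n) a' ∧
          ∀ b, HasFall (phaseSign i) (samples w n) (a n) b → a' ≤ b := by
      filter_upwards [hex] with n ⟨⟨b, _, hb⟩, _, hn⟩
      exact exists_next_entry hn ⟨b, hb⟩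
    obtain ⟨a', ha'⟩ := hex2.choice
    have hlow : ∀ᶠ n in atTop, τ (i + 1) ≤ gridPoint n (a' n) := by
      filter_upwards [ha', hent] with n ⟨_, _, _, _, _, ⟨j, j', q1, q2, q3, q4⟩, _⟩ ⟨hn, _⟩
      by_contra! hcon
      have := P.before (gridPoint n j) (gridPoint n j') (hn.trans (gridPoint_mono n q1))
        (gridPoint_mono n q2) ((gridPoint_mono n q3).trans_lt hcon)
      simp only [samples] at q4
      linarith
    have hupp : ∀ c, τ (i + 1) < c → ∀ᶠ n in atTop, gridPoint n (a' n) < c := by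
      intro c hc
      filter_upwards [hfall c hc, ha'] with n ⟨b, hb1, hb2⟩ ⟨_, _, _, _, _, _, hn⟩
      exact (gridPoint_mono n (hn b hb2)).trans_lt hb1
    have htend : Tendsto (fun n ↦ gridPoint n (a' n)) atTop (𝓝 (τ (i + 1))) := by
      refine tendsto_order.2 ⟨fun c hc ↦ ?_, fun c hc ↦ hupp c hc⟩
      filter_upwards [hlow] with n hn using hc.trans_le hn
    refine ⟨a', htend, ?_, fun j hj ↦ ?_⟩
    · filter_upwards [hlow, ha'] with n h1 ⟨_, h2, _⟩ using ⟨h1, h2⟩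
    rcases Nat.lt_succ_iff_lt_or_eq.1 hj with hj | rfl
    · refine (hgain j hj).congr' ?_
      filter_upwards [ha'] with n ⟨_, _, h3, _⟩ using (h3 j hj.ne).symm
    -- the gain of the phase which ends at `a'`
    have hva : Tendsto (fun n ↦ phaseSign j * w (gridPoint n (a n))) atTop
        (𝓝 (phaseSign j * w (τ j))) := (hvc.tendsto _).comp ha
    have hvj : Tendsto (fun n ↦ phaseSign j * w (gridPoint n (jn n))) atTop
        (𝓝 (phaseSign j * w (h j))) := (hvc.tendsto _).comp hjn
    -- The automaton runs slightly past `τ (j + 1)`; there the path is still below its extremum, so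
    -- the delay does not increase the gain.
    have hnear : ∀ᶠ x in 𝓝 (τ (j + 1)), phaseSign j * w x < phaseSign j * w (h j) :=
      (hvc.tendsto _).eventually_lt_const (by have := P.drop; linarith)
    obtain ⟨c, hc, hc'⟩ : ∃ c, τ (j + 1) < c ∧
        ∀ x ∈ Ico (τ (j + 1)) c, phaseSign j * w x < phaseSign j * w (h j) := by
      obtain ⟨c, hc, hc'⟩ := exists_Ico_subset_of_mem_nhds hnear ⟨τ (j + 1) + 1, by simp⟩
      exact ⟨c, hc, hc'⟩
    rw [mul_sub]
    refine tendsto_of_tendsto_of_tendsto_of_le_of_le' (hvj.sub hva)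
      (tendsto_const_nhds.sub hva) ?_ ?_
    · filter_upwards [ha', hlow, hjn.eventually_lt_const P.lt] with n ⟨_, _, _, _, h5, _⟩ e1 e2
      have := h5 (jn n) (hajn n) (gridPoint_lt_iff.1 (e2.trans_le e1))
      simp only [samples] at this
      linarith
    · filter_upwards [ha', hent, hupp c hc] with n ⟨_, _, _, ⟨l, hl1, hl2, hl3⟩, _⟩ ⟨e1, _⟩ e2
      rw [hl3]
      simp only [samples]
      have : phaseSign j * w (gridPoint n l) ≤ phaseSign j * w (h j) := by
        rcases le_or_gt (gridPoint n l) (τ (j + 1)) with e3 | e3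
        · exact P.le_max _ (e1.trans (gridPoint_mono n hl1)) e3
        · exact (hc' _ ⟨e3.le, (gridPoint_mono n hl2).trans_lt e2⟩).le
      linarith

/-- Up to a large time, the automaton reading the samples of a path on finer and finer grids
computes the gains of the phases. -/
lemma IsSkeleton.tendsto_phaseRun {w : ℝ≥0 → ℝ} {τ h : ℕ → ℝ≥0} (H : IsSkeleton w τ h)
    (hw : IsGenericPath w) {i : ℕ} {φ N : ℕ → ℕ} (hφ : Tendsto φ atTop atTop) {c : ℝ≥0}
    (hi : τ i < c) (hN : ∀ᶠ n in atTop, c ≤ gridPoint (φ n) (N n)) :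
    (∀ᶠ n in atTop, i ≤ (phaseRun (increments (samples w (φ n))) (N n)).1) ∧
      ∀ j < i, Tendsto (fun n ↦ (phaseRun (increments (samples w (φ n))) (N n)).2.2 j) atTop
        (𝓝 (phaseSign j * (w (h j) - w (τ j)))) := by
  obtain ⟨a, ha, hent, hgain⟩ := H.exists_entries hw i
  have hent' := hφ.eventually hent
  have hle : ∀ᶠ n in atTop, a (φ n) ≤ N n := by
    filter_upwards [hN, (ha.comp hφ).eventually_lt_const hi] with n h1 h2
    exact (gridPoint_lt_iff.1 (h2.trans_le h1)).le
  constructor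
  · filter_upwards [hle, hent'] with n h1 h2
    exact h2.2.1.ge.trans (phaseRun_frozen _ h1).1
  · intro j hj
    refine ((hgain j hj).comp hφ).congr' ?_
    filter_upwards [hle, hent'] with n h1 h2
    exact ((phaseRun_frozen _ h1).2 j (by rw [h2.2.1]; exact hj)).symm

/-! ### The discrete Azéma–Yor martingale. -/

/-- The product of the factors of the martingale `phaseMart` which only change when the running
maximum increases or a phase ends. -/
noncomputable def phasePrefix (P : ℕ) (θ : ℕ → ℝ) (s : PhaseState) : ℂ :=
  (∏ i ∈ Finset.range P, if i < s.1 then (1 - θ i * Complex.I : ℂ) else 1) *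
    Complex.exp (((∑ i ∈ Finset.range P, θ i * s.2.2 i : ℝ) : ℂ) * Complex.I)

/-- The frequency in the current phase. -/
noncomputable def phaseFreq (P : ℕ) (θ : ℕ → ℝ) (s : PhaseState) : ℝ :=
  if s.1 < P then θ s.1 else 0

/-- A discrete version of the Azéma–Yor martingale attached to the gains of the first `P` phases:
a product of factors `exp (I θ e) (1 - I θ d)`. -/
noncomputable def phaseMart (P : ℕ) (θ : ℕ → ℝ) (s : PhaseState) : ℂ :=
  phasePrefix P θ s * (1 - (phaseFreq P θ s * s.2.1 : ℝ) * Complex.I)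

/-- The integrand in the representation of `phaseMart` as a stochastic integral. -/
noncomputable def phaseIntegrand (P : ℕ) (θ : ℕ → ℝ) (s : PhaseState) : ℂ :=
  phasePrefix P θ s * ((phaseFreq P θ s * phaseSign s.1 : ℝ) * Complex.I)

/-- The total gain in the first `P` phases, plus the number of completed ones. -/
noncomputable def phaseVar (P : ℕ) (s : PhaseState) : ℝ :=
  ∑ i ∈ Finset.range P, (s.2.2 i + if i < s.1 then 1 else 0)

lemma norm_phasePrefix_le (P : ℕ) (θ : ℕ → ℝ) (s : PhaseState) :
    ‖phasePrefix P θ s‖ ≤ ∏ i ∈ Finset.range P, (1 + |θ i|) := by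
  rw [phasePrefix, norm_mul, Complex.norm_exp_ofReal_mul_I, mul_one, norm_prod]
  refine Finset.prod_le_prod (fun _ _ ↦ norm_nonneg _) fun i _ ↦ ?_
  split_ifs
  · refine (norm_sub_le _ _).trans ?_
    simp
  · simp

lemma abs_phaseFreq_le (P : ℕ) (θ : ℕ → ℝ) (s : PhaseState) :
    |phaseFreq P θ s| ≤ ∑ i ∈ Finset.range P, |θ i| := by
  unfold phaseFreq
  split_ifs with h
  · exact Finset.single_le_sum (f := fun i ↦ |θ i|) (fun i _ ↦ abs_nonneg _)
      (Finset.mem_range.2 h)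
  · simpa using Finset.sum_nonneg fun i _ ↦ abs_nonneg (θ i)

lemma norm_phaseMart_le (P : ℕ) (θ : ℕ → ℝ) (s : PhaseState) (h0 : 0 ≤ s.2.1) (h1 : s.2.1 < 1) :
    ‖phaseMart P θ s‖ ≤
      (∏ i ∈ Finset.range P, (1 + |θ i|)) * (1 + ∑ i ∈ Finset.range P, |θ i|) := by
  rw [phaseMart, norm_mul]
  gcongr
  · exact norm_phasePrefix_le P θ s
  · refine (norm_sub_le _ _).trans ?_
    rw [norm_one, norm_mul, Complex.norm_I, mul_one, Complex.norm_real, Real.norm_eq_abs, abs_mul,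
      abs_of_nonneg h0]
    gcongr
    calc |phaseFreq P θ s| * s.2.1 ≤ |phaseFreq P θ s| * 1 := by gcongr
      _ ≤ _ := by rw [mul_one]; exact abs_phaseFreq_le P θ s

lemma norm_phaseIntegrand_le (P : ℕ) (θ : ℕ → ℝ) (s : PhaseState) :
    ‖phaseIntegrand P θ s‖ ≤
      (∏ i ∈ Finset.range P, (1 + |θ i|)) * ∑ i ∈ Finset.range P, |θ i| := by
  rw [phaseIntegrand, norm_mul]
  gcongr
  · exact norm_phasePrefix_le P θ s
  · rw [norm_mul, Complex.norm_I, mul_one, Complex.norm_real, Real.norm_eq_abs, abs_mul,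
      abs_phaseSign, mul_one]
    exact abs_phaseFreq_le P θ s

lemma norm_exp_mul_I_sub_le (x : ℝ) :
    ‖Complex.exp (x * Complex.I) - 1 - x * Complex.I‖ ≤ 3 * x ^ 2 := by
  have hx : ‖(x : ℂ) * Complex.I‖ = |x| := by simp
  rcases le_or_gt |x| 1 with h | h
  · have := Complex.norm_exp_sub_one_sub_id_le (x := x * Complex.I) (by rw [hx]; exact h)
    rw [hx, sq_abs] at this
    nlinarith [sq_nonneg x]
  · calc _ ≤ ‖Complex.exp (x * Complex.I)‖ + ‖(1 : ℂ)‖ + ‖(x : ℂ) * Complex.I‖ :=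
          (norm_sub_le _ _).trans (by gcongr; exact norm_sub_le _ _)
      _ = 2 + |x| := by rw [Complex.norm_exp_ofReal_mul_I, norm_one, hx]; ring
      _ ≤ 3 * x ^ 2 := by rw [← sq_abs]; nlinarith

/-- Below the maximum `phaseMart` is affine in the increment and there is no error. When the maximum
moves, the error is the second-order remainder of the exponential (the term `3 * Θ ^ 2`); when a
phase ends, it is the overshoot beyond drawdown 1 (the term `Θ`). Both are at most a constant times
`|ξ|` times the growth of `phaseVar`, so they sum to the largest increment times a bounded quantity.
-/
lemma norm_phaseMart_step_le (P : ℕ) (θ : ℕ → ℝ) (ξ : ℝ) (s : PhaseState)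
    (h0 : 0 ≤ s.2.1) (h1 : s.2.1 < 1) :
    0 ≤ phaseVar P (phaseStep ξ s) - phaseVar P s ∧
    ‖phaseMart P θ (phaseStep ξ s) - phaseMart P θ s - phaseIntegrand P θ s * ξ‖ ≤
      (∏ i ∈ Finset.range P, (1 + |θ i|)) * (3 * (∑ i ∈ Finset.range P, |θ i|) ^ 2 +
        ∑ i ∈ Finset.range P, |θ i|) * |ξ| * (phaseVar P (phaseStep ξ s) - phaseVar P s) := by
  set A := ∏ i ∈ Finset.range P, (1 + |θ i|)
  set Θ := ∑ i ∈ Finset.range P, |θ i|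
  have hA : 0 ≤ A := Finset.prod_nonneg fun i _ ↦ by positivity
  have hΘ : 0 ≤ Θ := Finset.sum_nonneg fun i _ ↦ abs_nonneg _
  have hpre := norm_phasePrefix_le P θ s
  have hfreq := abs_phaseFreq_le P θ s
  set κ := phaseFreq P θ s with hκ
  have habs : |phaseSign s.1 * ξ| = |ξ| := by rw [abs_mul, abs_phaseSign, one_mul]
  set Δ := phaseSign s.1 * ξ with hΔ
  have hH : phaseIntegrand P θ s * ξ = phasePrefix P θ s * ((κ * Δ : ℝ) * Complex.I) := by
    rw [phaseIntegrand, hΔ]; push_cast; ring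
  rw [hH]
  rcases phaseStep_cases ξ s with ⟨c1, c2⟩ | ⟨c1, c2, c3⟩ | ⟨c1, c2⟩
  · -- the running maximum increases
    rw [← hΔ] at c1
    have hV : phaseVar P (phaseStep ξ s) - phaseVar P s = if s.1 < P then Δ - s.2.1 else 0 := by
      rw [c2, phaseVar, phaseVar, ← Finset.sum_sub_distrib]
      rw [Finset.sum_congr rfl (fun i _ ↦ show (s.2.2 i + (if i = s.1 then phaseSign s.1 * ξ - s.2.1
        else 0) + if i < s.1 then (1 : ℝ) else 0) - (s.2.2 i + if i < s.1 then 1 else 0) =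
        if i = s.1 then Δ - s.2.1 else 0 by rw [hΔ]; ring)]
      simp
    have hpre' : phasePrefix P θ (phaseStep ξ s) =
        phasePrefix P θ s * Complex.exp ((κ * (Δ - s.2.1) : ℝ) * Complex.I) := by
      rw [c2, phasePrefix, phasePrefix, mul_assoc, ← Complex.exp_add, ← add_mul,
        ← Complex.ofReal_add]
      congr 4
      rw [Finset.sum_congr rfl (fun i _ ↦ show θ i * (s.2.2 i + if i = s.1 then phaseSign s.1 * ξ -
        s.2.1 else 0) = θ i * s.2.2 i + if i = s.1 then θ i * (Δ - s.2.1) else 0 by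
          split_ifs <;> simp [hΔ, mul_add])]
      rw [Finset.sum_add_distrib, Finset.sum_ite_eq']
      simp only [Finset.mem_range, hκ, phaseFreq]
      split_ifs <;> simp
    have hZ : phaseMart P θ (phaseStep ξ s) = phasePrefix P θ (phaseStep ξ s) := by
      rw [phaseMart, c2]; simp
    rw [hV]
    refine ⟨by split_ifs <;> linarith, ?_⟩
    have hdiff : phaseMart P θ (phaseStep ξ s) - phaseMart P θ s -
        phasePrefix P θ s * ((κ * Δ : ℝ) * Complex.I) = phasePrefix P θ s *
        (Complex.exp ((κ * (Δ - s.2.1) : ℝ) * Complex.I) - 1 -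
          (κ * (Δ - s.2.1) : ℝ) * Complex.I) := by
      rw [hZ, hpre', phaseMart, ← hκ]; push_cast; ring
    rw [hdiff, norm_mul]
    have e1 := norm_exp_mul_I_sub_le (κ * (Δ - s.2.1))
    have hu : Δ - s.2.1 ≤ |ξ| := by have := le_abs_self Δ; linarith
    split_ifs with hP
    · calc _ ≤ A * (3 * (κ * (Δ - s.2.1)) ^ 2) := by gcongr
        _ = A * (3 * |κ| ^ 2) * (Δ - s.2.1) * (Δ - s.2.1) := by rw [sq_abs]; ring
        _ ≤ A * (3 * Θ ^ 2 + Θ) * |ξ| * (Δ - s.2.1) := by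
          have : 0 ≤ Δ - s.2.1 := by linarith
          gcongr
          have : |κ| ^ 2 ≤ Θ ^ 2 := by gcongr
          linarith
    · have : κ = 0 := by rw [hκ, phaseFreq, if_neg hP]
      simp [this]
  · -- the path stays strictly between the maximum and the threshold
    rw [c3]
    have hZ : phaseMart P θ (s.1, s.2.1 - phaseSign s.1 * ξ, s.2.2) - phaseMart P θ s -
        phasePrefix P θ s * ((κ * Δ : ℝ) * Complex.I) = 0 := by
      have e1 : phasePrefix P θ (s.1, s.2.1 - phaseSign s.1 * ξ, s.2.2) = phasePrefix P θ s := rfl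
      have e2 : phaseFreq P θ (s.1, s.2.1 - phaseSign s.1 * ξ, s.2.2) = phaseFreq P θ s := rfl
      rw [phaseMart, phaseMart, e1, e2, ← hκ, ← hΔ]; push_cast; ring
    rw [hZ]
    simp [phaseVar]
  · -- the phase ends
    rw [← hΔ] at c1
    have hV : phaseVar P (phaseStep ξ s) - phaseVar P s = if s.1 < P then 1 else 0 := by
      rw [c2, phaseVar, phaseVar, ← Finset.sum_sub_distrib]
      rw [Finset.sum_congr rfl (fun i _ ↦ show (s.2.2 i + if i < s.1 + 1 then (1 : ℝ) else 0) -
        (s.2.2 i + if i < s.1 then 1 else 0) = if i = s.1 then 1 else 0 by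
          split_ifs <;> first | omega | ring)]
      simp
    have hpre' : phasePrefix P θ (phaseStep ξ s) =
        phasePrefix P θ s * (1 - κ * Complex.I) := by
      rw [c2, phasePrefix, phasePrefix, mul_right_comm]
      congr 1
      rw [Finset.prod_congr rfl (fun i _ ↦ show (if i < s.1 + 1 then (1 - θ i * Complex.I : ℂ)
        else 1) = (if i < s.1 then (1 - θ i * Complex.I : ℂ) else 1) *
        if i = s.1 then (1 - θ i * Complex.I : ℂ) else 1 by
          split_ifs <;> first | omega | ring)]
      rw [Finset.prod_mul_distrib, Finset.prod_ite_eq']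
      congr 1
      simp only [Finset.mem_range, hκ, phaseFreq]
      split_ifs <;> simp
    have hZ : phaseMart P θ (phaseStep ξ s) = phasePrefix P θ (phaseStep ξ s) := by
      rw [phaseMart, c2]; simp
    rw [hV]
    refine ⟨by split_ifs <;> linarith, ?_⟩
    have hdiff : phaseMart P θ (phaseStep ξ s) - phaseMart P θ s -
        phasePrefix P θ s * ((κ * Δ : ℝ) * Complex.I) = phasePrefix P θ s *
        ((κ * (s.2.1 - Δ - 1) : ℝ) * Complex.I) := by
      rw [hZ, hpre', phaseMart, ← hκ]; push_cast; ring
    rw [hdiff, norm_mul, norm_mul, Complex.norm_I, mul_one, Complex.norm_real, Real.norm_eq_abs,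
      abs_mul, abs_of_nonneg (show 0 ≤ s.2.1 - Δ - 1 by linarith)]
    have hu : s.2.1 - Δ - 1 ≤ |ξ| := by have := neg_abs_le Δ; linarith
    split_ifs with hP
    · calc _ ≤ A * (Θ * |ξ|) := by
            have : 0 ≤ s.2.1 - Δ - 1 := by linarith
            gcongr
        _ ≤ A * (3 * Θ ^ 2 + Θ) * |ξ| * 1 := by
          have : 0 ≤ A * (3 * Θ ^ 2) * |ξ| := by positivity
          linarith
    · have : κ = 0 := by rw [hκ, phaseFreq, if_neg hP]
      simp [this]

/-- The stochastic integral of `phaseIntegrand`. -/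
noncomputable def phaseIntegral (P : ℕ) (θ : ℕ → ℝ) (ξ : ℕ → ℝ) (N : ℕ) : ℂ :=
  ∑ k ∈ Finset.range N, phaseIntegrand P θ (phaseRun ξ k) * ξ k

lemma norm_phaseMart_sub_integral_le (P : ℕ) (θ ξ : ℕ → ℝ) (N : ℕ) {M : ℝ}
    (hM : ∀ k < N, |ξ k| ≤ M) :
    0 ≤ phaseVar P (phaseRun ξ N) ∧
    ‖phaseMart P θ (phaseRun ξ N) - 1 - phaseIntegral P θ ξ N‖ ≤
      (∏ i ∈ Finset.range P, (1 + |θ i|)) * (3 * (∑ i ∈ Finset.range P, |θ i|) ^ 2 +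
        ∑ i ∈ Finset.range P, |θ i|) * M * phaseVar P (phaseRun ξ N) := by
  set A := ∏ i ∈ Finset.range P, (1 + |θ i|) with hA'
  set Θ := ∑ i ∈ Finset.range P, |θ i| with hΘ'
  have hA : 0 ≤ A := Finset.prod_nonneg fun i _ ↦ by positivity
  have hΘ : 0 ≤ Θ := Finset.sum_nonneg fun i _ ↦ abs_nonneg _
  induction N with
  | zero =>
    simp [phaseRun, phaseMart, phasePrefix, phaseIntegral, phaseVar]
  | succ N ih =>
    obtain ⟨i1, i2⟩ := ih fun k hk ↦ hM k (by omega)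
    obtain ⟨⟨h0, h1⟩, -⟩ := phaseRun_invariant ξ N
    obtain ⟨s1, s2⟩ := norm_phaseMart_step_le P θ (ξ N) (phaseRun ξ N) h0 h1
    rw [← hA', ← hΘ'] at s2
    rw [phaseRun]
    refine ⟨by linarith, ?_⟩
    rw [phaseIntegral, Finset.sum_range_succ, ← phaseIntegral]
    calc _ = ‖(phaseMart P θ (phaseRun ξ N) - 1 - phaseIntegral P θ ξ N) +
          (phaseMart P θ (phaseStep (ξ N) (phaseRun ξ N)) - phaseMart P θ (phaseRun ξ N) -
            phaseIntegrand P θ (phaseRun ξ N) * ξ N)‖ := by congr 1; ring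
      _ ≤ A * (3 * Θ ^ 2 + Θ) * M * phaseVar P (phaseRun ξ N) + A * (3 * Θ ^ 2 + Θ) * M *
          (phaseVar P (phaseStep (ξ N) (phaseRun ξ N)) - phaseVar P (phaseRun ξ N)) := by
        refine (norm_add_le _ _).trans (add_le_add i2 (s2.trans ?_))
        gcongr
        exact hM N (by omega)
      _ = _ := by ring

lemma phaseVar_le (P : ℕ) (y : ℕ → ℝ) {K : ℝ} (N : ℕ)
    (hK : ∀ i ≤ N, ∀ j ≤ N, |y i - y j| ≤ K) :
    phaseVar P (phaseRun (increments y) N) ≤ P * (K + 1) := by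
  have := (phaseRun_gain_le y N hK le_rfl).1
  rw [phaseVar]
  refine (Finset.sum_le_card_nsmul _ _ (K + 1) fun i _ ↦ ?_).trans (by simp [mul_add])
  have := this i
  split_ifs <;> linarith

lemma phaseMart_of_le {P : ℕ} {θ : ℕ → ℝ} {s : PhaseState} (hs : P ≤ s.1) :
    phaseMart P θ s = (∏ i ∈ Finset.range P, (1 - θ i * Complex.I : ℂ)) *
      Complex.exp (((∑ i ∈ Finset.range P, θ i * s.2.2 i : ℝ) : ℂ) * Complex.I) := by
  rw [phaseMart, phaseFreq, if_neg (by omega), phasePrefix]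
  simp only [zero_mul, Complex.ofReal_zero, sub_zero, mul_one]
  congr 1
  refine Finset.prod_congr rfl fun i hi ↦ if_pos ?_
  exact (Finset.mem_range.1 hi).trans_le hs

/-- On a fixed time interval, the difference between `phaseMart` and its stochastic integral
representation vanishes as the mesh of the grid goes to `0`. -/
lemma tendsto_phaseMart_sub_integral (P : ℕ) (θ : ℕ → ℝ) {w : ℝ≥0 → ℝ} (hw : Continuous w)
    (T : ℕ) : Tendsto (fun n ↦ phaseMart P θ (phaseRun (increments (samples w n)) (T * (n + 1))) -
      1 - phaseIntegral P θ (increments (samples w n)) (T * (n + 1))) atTop (𝓝 0) := by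
  have hmem : ∀ n k, k ≤ T * (n + 1) → gridPoint n k ∈ Icc (0 : ℝ≥0) T := by
    intro n k hk
    refine ⟨zero_le, ?_⟩
    rw [gridPoint, div_le_iff₀ (by positivity)]
    exact_mod_cast hk
  have huc : UniformContinuousOn w (Icc (0 : ℝ≥0) T) :=
    isCompact_Icc.uniformContinuousOn_of_continuous hw.continuousOn
  obtain ⟨K, hK⟩ := (isCompact_Icc (a := (0 : ℝ≥0)) (b := T)).exists_bound_of_continuousOn
    hw.continuousOn
  have hK' : ∀ n, ∀ i ≤ T * (n + 1), ∀ j ≤ T * (n + 1),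
      |samples w n i - samples w n j| ≤ 2 * K := by
    intro n i hi j hj
    have e1 := hK _ (hmem n i hi)
    have e2 := hK _ (hmem n j hj)
    refine (abs_sub _ _).trans ?_
    simp only [Real.norm_eq_abs] at e1 e2
    simp only [samples]
    linarith
  set A := (∏ i ∈ Finset.range P, (1 + |θ i|)) * (3 * (∑ i ∈ Finset.range P, |θ i|) ^ 2 +
        ∑ i ∈ Finset.range P, |θ i|) with hA
  have hA0 : 0 ≤ A := mul_nonneg (Finset.prod_nonneg fun i _ ↦ by positivity)
    (by have : 0 ≤ ∑ i ∈ Finset.range P, |θ i| := Finset.sum_nonneg fun i _ ↦ abs_nonneg _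
        positivity)
  have hK0 : 0 ≤ K := (norm_nonneg _).trans (hK 0 ⟨le_rfl, zero_le⟩)
  rw [Metric.tendsto_atTop]
  intro ε hε
  obtain ⟨M, hM0, hM⟩ : ∃ M > 0, A * M * (P * (2 * K + 1)) < ε := by
    refine ⟨ε / (A * (P * (2 * K + 1)) + 1), by positivity, ?_⟩
    rw [show A * (ε / (A * (P * (2 * K + 1)) + 1)) * (P * (2 * K + 1)) =
      ε * ((A * (P * (2 * K + 1))) / (A * (P * (2 * K + 1)) + 1)) by ring]
    have : A * (P * (2 * K + 1)) / (A * (P * (2 * K + 1)) + 1) < 1 := by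
      rw [div_lt_one (by positivity)]; linarith
    nlinarith
  obtain ⟨δ, hδ, hδ'⟩ := Metric.uniformContinuousOn_iff.1 huc M hM0
  obtain ⟨n₀, hn₀⟩ := exists_nat_one_div_lt hδ
  refine ⟨n₀, fun n hn ↦ ?_⟩
  rw [dist_zero_right]
  have hinc : ∀ k < T * (n + 1), |increments (samples w n) k| ≤ M := by
    intro k hk
    refine (hδ' _ (hmem n (k + 1) hk) _ (hmem n k hk.le) ?_).le
    rw [NNReal.dist_eq]
    have : ((gridPoint n (k + 1) : ℝ≥0) : ℝ) - gridPoint n k = 1 / ((n : ℝ) + 1) := by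
      simp only [gridPoint]; push_cast; field_simp; ring
    rw [this, abs_of_pos (by positivity)]
    refine lt_of_le_of_lt ?_ hn₀
    gcongr
  obtain ⟨v0, hv⟩ := norm_phaseMart_sub_integral_le P θ (increments (samples w n)) (T * (n + 1)) hinc
  refine hv.trans_lt (lt_of_le_of_lt ?_ hM)
  rw [← hA]
  gcongr
  exact phaseVar_le P (samples w n) _ (hK' n)

/-! ### Measurability, and dependence on finitely many increments. -/

lemma measurable_phaseSign_fst : Measurable (fun s : PhaseState ↦ phaseSign s.1) :=
  (measurable_of_countable phaseSign).comp measurable_fst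

lemma measurable_phaseFreq (P : ℕ) (θ : ℕ → ℝ) : Measurable (phaseFreq P θ) :=
  (measurable_of_countable (fun p : ℕ ↦ if p < P then θ p else 0)).comp measurable_fst

lemma measurable_gain (i : ℕ) : Measurable (fun s : PhaseState ↦ s.2.2 i) :=
  (measurable_pi_apply i).comp (measurable_snd.comp measurable_snd)

lemma measurable_phasePrefix (P : ℕ) (θ : ℕ → ℝ) : Measurable (phasePrefix P θ) := by
  refine Measurable.mul ?_ ?_
  · exact (measurable_of_countable (fun p : ℕ ↦ ∏ i ∈ Finset.range P,
      if i < p then (1 - θ i * Complex.I : ℂ) else 1)).comp measurable_fst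
  · refine Complex.measurable_exp.comp (Measurable.mul_const (Complex.measurable_ofReal.comp ?_) _)
    exact Finset.measurable_fun_sum _ fun i _ ↦ (measurable_gain i).const_mul _

lemma measurable_phaseMart (P : ℕ) (θ : ℕ → ℝ) : Measurable (phaseMart P θ) := by
  have h1 := measurable_phasePrefix P θ
  have h2 := measurable_phaseFreq P θ
  unfold phaseMart
  fun_prop

lemma measurable_phaseIntegrand (P : ℕ) (θ : ℕ → ℝ) : Measurable (phaseIntegrand P θ) := by
  have h1 := measurable_phasePrefix P θ
  have h2 := measurable_phaseFreq P θ
  have h3 := measurable_phaseSign_fst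
  unfold phaseIntegrand
  fun_prop

lemma measurable_phaseStep :
    Measurable (fun q : ℝ × PhaseState ↦ phaseStep q.1 q.2) := by
  have h1 : Measurable (fun q : ℝ × PhaseState ↦ phaseSign q.2.1) :=
    measurable_phaseSign_fst.comp measurable_snd
  unfold phaseStep
  refine Measurable.ite (measurableSet_le measurable_const (by fun_prop)) ?_ ?_
  · refine Measurable.prodMk ?_ (by fun_prop)
    exact (measurable_of_countable (fun p : ℕ ↦ p + 1)).comp (by fun_prop)
  · refine Measurable.prodMk (by fun_prop) (Measurable.prodMk (by fun_prop) ?_)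
    refine measurable_pi_lambda _ fun i ↦ ?_
    refine Measurable.add ((measurable_gain i).comp measurable_snd) ?_
    refine Measurable.ite ?_ (by fun_prop) measurable_const
    exact (measurable_fst.comp measurable_snd) (MeasurableSet.singleton i) |>.congr
      (by ext q; simp [eq_comm])

lemma measurable_increments_samples (n k : ℕ) :
    Measurable (fun w : ℝ≥0 → ℝ ↦ increments (samples w n) k) := by
  unfold increments samples
  fun_prop

lemma measurable_phaseRun (n k : ℕ) :
    Measurable (fun w : ℝ≥0 → ℝ ↦ phaseRun (increments (samples w n)) k) := by
  induction k with
  | zero => exact measurable_const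
  | succ k ih => exact measurable_phaseStep.comp ((measurable_increments_samples n k).prodMk ih)

lemma measurable_phaseIntegral (P : ℕ) (θ : ℕ → ℝ) (n k : ℕ) :
    Measurable (fun w : ℝ≥0 → ℝ ↦ phaseIntegral P θ (increments (samples w n)) k) := by
  refine Finset.measurable_fun_sum _ fun j _ ↦ ?_
  exact ((measurable_phaseIntegrand P θ).comp (measurable_phaseRun n j)).mul
    (Complex.measurable_ofReal.comp (measurable_increments_samples n j))

lemma phaseRun_congr {ξ ξ' : ℕ → ℝ} {k : ℕ} (h : ∀ j < k, ξ j = ξ' j) :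
    phaseRun ξ k = phaseRun ξ' k := by
  induction k with
  | zero => rfl
  | succ k ih => rw [phaseRun, phaseRun, ih fun j hj ↦ h j (by omega), h k (by omega)]

lemma phaseIntegral_congr (P : ℕ) (θ : ℕ → ℝ) {ξ ξ' : ℕ → ℝ} {k : ℕ} (h : ∀ j < k, ξ j = ξ' j) :
    phaseIntegral P θ ξ k = phaseIntegral P θ ξ' k := by
  refine Finset.sum_congr rfl fun j hj ↦ ?_
  rw [Finset.mem_range] at hj
  rw [phaseRun_congr fun l hl ↦ h l (by omega), h j hj]

/-! ### Second moments and passage to the limit in expectations. -/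

/-- Discrete stochastic integrals of bounded integrands are centered and bounded in `L²`. -/
lemma integral_sum_mul_of_indepFun {Ω : Type*} [MeasurableSpace Ω] {P : Measure Ω}
    [IsProbabilityMeasure P] {ξ : ℕ → Ω → ℝ} {H : ℕ → Ω → ℂ} {C v : ℝ}
    (hξ : ∀ k, MemLp (ξ k) 2 P) (hmean : ∀ k, ∫ ω, ξ k ω ∂P = 0)
    (hvar : ∀ k, ∫ ω, ξ k ω ^ 2 ∂P ≤ v)
    (hHm : ∀ k, AEMeasurable (H k) P) (hH : ∀ k ω, ‖H k ω‖ ≤ C)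
    (hind : ∀ k, IndepFun (ξ k)
      (fun ω ↦ (H k ω, ∑ j ∈ Finset.range k, H j ω * ξ j ω)) P) (N : ℕ) :
    MemLp (fun ω ↦ ∑ j ∈ Finset.range N, H j ω * ξ j ω) 2 P ∧
    ∫ ω, ∑ j ∈ Finset.range N, H j ω * ξ j ω ∂P = 0 ∧
    ∫ ω, ‖∑ j ∈ Finset.range N, H j ω * ξ j ω‖ ^ 2 ∂P ≤ N * (C ^ 2 * v) := by
  have hC : 0 ≤ C := by
    obtain ⟨ω⟩ : Nonempty Ω := P.nonempty_of_neZero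
    exact (norm_nonneg _).trans (hH 0 ω)
  have hmem : ∀ k, MemLp (fun ω ↦ H k ω * (ξ k ω : ℂ)) 2 P := by
    intro k
    refine MemLp.of_le_mul (c := C) (hξ k) ?_ (Eventually.of_forall fun ω ↦ ?_)
    · have := (hξ k).aestronglyMeasurable.aemeasurable
      exact ((hHm k).mul (Complex.measurable_ofReal.comp_aemeasurable this)).aestronglyMeasurable
    · rw [norm_mul, Complex.norm_real]
      gcongr
      exact hH k ω
  induction N with
  | zero => simp
  | succ N ih =>
    obtain ⟨h1, h2, h3⟩ := ih
    simp only [Finset.sum_range_succ]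
    set R : Ω → ℂ := fun ω ↦ ∑ j ∈ Finset.range N, H j ω * ξ j ω with hR
    have hpair : AEMeasurable (fun ω ↦ (H N ω, R ω)) P :=
      (hHm N).prodMk h1.aestronglyMeasurable.aemeasurable
    have hξm := (hξ N).aestronglyMeasurable.aemeasurable
    refine ⟨h1.add (hmem N), ?_, ?_⟩
    · rw [integral_add (h1.integrable (by norm_num)) ((hmem N).integrable (by norm_num)), h2]
      have := (hind N).integral_fun_comp_smul_comp (𝕜 := ℝ) (f := id) (g := Prod.fst) hξm hpair
        measurable_id.aestronglyMeasurable measurable_fst.aestronglyMeasurable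
      simp only [id, hmean, zero_smul] at this
      rw [zero_add, ← this]
      refine integral_congr_ae (Eventually.of_forall fun ω ↦ ?_)
      simp [mul_comm]
    · have hcross := (hind N).integral_fun_comp_mul_comp (𝕜 := ℝ) (f := id)
        (g := fun q : ℂ × ℂ ↦ (q.2 * (starRingEnd ℂ) q.1).re) hξm hpair
        measurable_id.aestronglyMeasurable (by fun_prop)
      simp only [id, hmean, zero_mul] at hcross
      have hexp : ∀ ω, ‖R ω + H N ω * ξ N ω‖ ^ 2 = ‖R ω‖ ^ 2 +
          2 * (ξ N ω * (R ω * (starRingEnd ℂ) (H N ω)).re) + ‖H N ω * ξ N ω‖ ^ 2 := by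
        intro ω
        rw [← Complex.normSq_eq_norm_sq, Complex.normSq_add, Complex.normSq_eq_norm_sq,
          Complex.normSq_eq_norm_sq, map_mul, Complex.conj_ofReal, ← mul_assoc,
          Complex.re_mul_ofReal]
        ring
      have i1 : Integrable (fun ω ↦ ‖R ω‖ ^ 2) P := h1.integrable_norm_pow (by norm_num)
      have i3 : Integrable (fun ω ↦ ‖H N ω * ξ N ω‖ ^ 2) P :=
        (hmem N).integrable_norm_pow (by norm_num)
      have i2 : Integrable (fun ω ↦ ‖R ω + H N ω * ξ N ω‖ ^ 2) P :=
        (h1.add (hmem N)).integrable_norm_pow (by norm_num)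
      have i4 : Integrable (fun ω ↦ 2 * (ξ N ω * (R ω * (starRingEnd ℂ) (H N ω)).re)) P := by
        refine ((i2.sub i1).sub i3).congr (Eventually.of_forall fun ω ↦ ?_)
        simp only [Pi.sub_apply, hexp]
        ring
      change ∫ ω, ‖R ω‖ ^ 2 ∂P ≤ _ at h3
      change ∫ ω, ‖R ω + H N ω * ξ N ω‖ ^ 2 ∂P ≤ _
      simp only [hexp]
      have i5 : Integrable (fun ω ↦ ‖R ω‖ ^ 2 +
          2 * (ξ N ω * (R ω * (starRingEnd ℂ) (H N ω)).re)) P := i1.add i4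
      change ∫ ω, ξ N ω * (R ω * (starRingEnd ℂ) (H N ω)).re ∂P = 0 at hcross
      rw [integral_add i5 i3, integral_add i1 i4, integral_const_mul, hcross]
      have hlast : ∫ ω, ‖H N ω * ξ N ω‖ ^ 2 ∂P ≤ C ^ 2 * v := by
        calc _ ≤ ∫ ω, C ^ 2 * ξ N ω ^ 2 ∂P := by
              refine integral_mono i3 ((hξ N).integrable_sq.const_mul _) fun ω ↦ ?_
              simp only [norm_mul, Complex.norm_real, mul_pow, Real.norm_eq_abs, sq_abs]
              gcongr
              exact hH N ω
          _ ≤ _ := by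
              rw [integral_const_mul]
              gcongr
              exact hvar N
      push_cast
      linarith

/-- The `L²` bound gives uniform integrability through `‖X‖ ≤ min ‖X‖ M + ‖X‖ ^ 2 / M`: the first
term is handled by dominated convergence, the second by taking `M` large. -/
lemma tendsto_integral_of_sq_bounded {Ω : Type*} [MeasurableSpace Ω] {P : Measure Ω}
    [IsProbabilityMeasure P] {X : ℕ → Ω → ℂ} {K : ℝ} (hX : ∀ n, MemLp (X n) 2 P)
    (hK : ∀ n, ∫ ω, ‖X n ω‖ ^ 2 ∂P ≤ K)
    (hlim : ∀ᵐ ω ∂P, Tendsto (fun n ↦ X n ω) atTop (𝓝 0)) :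
    Tendsto (fun n ↦ ∫ ω, X n ω ∂P) atTop (𝓝 0) := by
  have hK0 : 0 ≤ K := (integral_nonneg fun ω ↦ by positivity).trans (hK 0)
  have hint : ∀ n, Integrable (fun ω ↦ ‖X n ω‖) P := fun n ↦ ((hX n).integrable (by norm_num)).norm
  have hmin : ∀ M : ℝ, 0 < M →
      Tendsto (fun n ↦ ∫ ω, min ‖X n ω‖ M ∂P) atTop (𝓝 0) := by
    intro M hM
    have := tendsto_integral_of_dominated_convergence (μ := P) (F := fun n ω ↦ min ‖X n ω‖ M)
      (f := fun _ ↦ (0 : ℝ)) (fun _ ↦ M)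
      (fun n ↦ ((hint n).aestronglyMeasurable.inf aestronglyMeasurable_const))
      (integrable_const M) (fun n ↦ Eventually.of_forall fun ω ↦ by
        rw [Real.norm_of_nonneg (by positivity)]; exact min_le_right _ _) (by
        filter_upwards [hlim] with ω hω
        have h1 := (hω.norm).min (tendsto_const_nhds (x := M))
        rwa [norm_zero, min_eq_left hM.le] at h1)
    simpa using this
  rw [Metric.tendsto_atTop]
  intro ε hε
  obtain ⟨M, hM0, hM⟩ : ∃ M > 0, K / M < ε / 2 := by
    refine ⟨2 * K / ε + 1, by positivity, ?_⟩
    rw [div_lt_iff₀ (by positivity)]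
    field_simp
    linarith
  obtain ⟨n₀, hn₀⟩ := Metric.tendsto_atTop.1 (hmin M hM0) (ε / 2) (by positivity)
  refine ⟨n₀, fun n hn ↦ ?_⟩
  have h1 := hn₀ n hn
  rw [dist_zero_right, Real.norm_eq_abs] at h1
  rw [dist_zero_right]
  have isq : Integrable (fun ω ↦ ‖X n ω‖ ^ 2 / M) P :=
    ((hX n).integrable_norm_pow (by norm_num)).div_const _
  have imin : Integrable (fun ω ↦ min ‖X n ω‖ M) P := (hint n).inf (integrable_const M)
  calc ‖∫ ω, X n ω ∂P‖ ≤ ∫ ω, ‖X n ω‖ ∂P := norm_integral_le_integral_norm _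
    _ ≤ ∫ ω, (min ‖X n ω‖ M + ‖X n ω‖ ^ 2 / M) ∂P := by
      refine integral_mono (hint n) (imin.add isq) fun ω ↦ ?_
      simp only
      rcases le_total ‖X n ω‖ M with h | h
      · rw [min_eq_left h]
        have : 0 ≤ ‖X n ω‖ ^ 2 / M := by positivity
        linarith
      · rw [min_eq_right h]
        have : ‖X n ω‖ ≤ ‖X n ω‖ ^ 2 / M := by
          rw [le_div_iff₀ hM0, sq]
          gcongr
        linarith
    _ = ∫ ω, min ‖X n ω‖ M ∂P + (∫ ω, ‖X n ω‖ ^ 2 ∂P) / M := by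
      rw [integral_add imin isq, integral_div]
    _ < ε / 2 + ε / 2 := by
      have h2 : (∫ ω, ‖X n ω‖ ^ 2 ∂P) / M ≤ K / M := by gcongr; exact hK n
      have := le_abs_self (∫ ω, min ‖X n ω‖ M ∂P)
      linarith
    _ = ε := by ring

/-! ### Brownian motion: increments and the limit of the discrete martingale. -/

section Brownian

variable {Ω : Type*} [MeasurableSpace Ω] {P : Measure Ω} {c : ℝ} {V : ℝ≥0 → Ω → ℝ}

namespace IsBrownianWithDiffusion

lemma aemeasurable (hV : IsBrownianWithDiffusion c V P) (t : ℝ≥0) : AEMeasurable (V t) P := by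
  obtain ⟨B, hB, h⟩ := hV
  have : V t = fun ω ↦ c * B t ω := funext fun ω ↦ h t ω
  rw [this]
  exact (hB.aemeasurable t).const_mul c

lemma cont (hV : IsBrownianWithDiffusion c V P) : ∀ᵐ ω ∂P, Continuous (V · ω) := by
  obtain ⟨B, hB, h⟩ := hV
  filter_upwards [hB.cont] with ω hω
  simp only [h]
  fun_prop

lemma shift (hV : IsBrownianWithDiffusion c V P) (t₀ : ℝ≥0) :
    IsBrownianWithDiffusion c (fun t ω ↦ V (t₀ + t) ω - V t₀ ω) P := by
  obtain ⟨B, hB, h⟩ := hV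
  exact ⟨_, hB.shift t₀, fun t ω ↦ by simp only [h]; ring⟩

lemma div_const (hV : IsBrownianWithDiffusion c V P) (a : ℝ) :
    IsBrownianWithDiffusion (c / a) (fun t ω ↦ V t ω / a) P := by
  obtain ⟨B, hB, h⟩ := hV
  exact ⟨B, hB, fun t ω ↦ by simp only [h]; ring⟩

lemma neg (hV : IsBrownianWithDiffusion c V P) :
    IsBrownianWithDiffusion c (fun t ω ↦ - V t ω) P := by
  obtain ⟨B, hB, h⟩ := hV
  exact ⟨_, hB.neg, fun t ω ↦ by simp [h]⟩

lemma hasLaw_increment (hV : IsBrownianWithDiffusion c V P) (t₀ t : ℝ≥0) :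
    HasLaw (fun ω ↦ V (t₀ + t) ω - V t₀ ω) (gaussianReal 0 (‖c‖₊ ^ 2 * t)) P := by
  obtain ⟨B, hB, h⟩ := hV.shift t₀
  have := gaussianReal_const_mul (hB.hasLaw_eval t) c
  rw [mul_zero, show NNReal.mk (c ^ 2) (sq_nonneg _) = ‖c‖₊ ^ 2 from NNReal.eq (by simp)] at this
  refine this.congr (Eventually.of_forall fun ω ↦ h t ω)

lemma indepFun_shift (hV : IsBrownianWithDiffusion c V P) (t₀ : ℝ≥0) {α β : Type*}
    [MeasurableSpace α] [MeasurableSpace β] {F : (ℝ≥0 → ℝ) → α} {G : (ℝ≥0 → ℝ) → β}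
    (hF : Measurable F) (hG : Measurable G)
    (hloc : ∀ w w' : ℝ≥0 → ℝ, (∀ t ≤ t₀, w t = w' t) → G w = G w') :
    IndepFun (fun ω ↦ F (fun t ↦ V (t₀ + t) ω - V t₀ ω)) (fun ω ↦ G (V · ω)) P := by
  classical
  obtain ⟨B, hB, h⟩ := hV
  -- A path known up to `t₀` is extended by 0; by `hloc`, `G` does not see the extension.
  let ext : (Set.Iic t₀ → ℝ) → ℝ≥0 → ℝ := fun f t ↦ if ht : t ≤ t₀ then c * f ⟨t, ht⟩ else 0
  have hext : Measurable ext := by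
    refine measurable_pi_lambda _ fun t ↦ ?_
    by_cases ht : t ≤ t₀
    · simp only [ext, ht, dif_pos]
      fun_prop
    · simp only [ext, ht, dif_neg, not_false_eq_true]
      exact measurable_const
  have hmul : Measurable (fun (w : ℝ≥0 → ℝ) (t : ℝ≥0) ↦ c * w t) :=
    measurable_pi_lambda _ fun t ↦ by fun_prop
  have key := (hB.toIsPreBrownianReal.indepFun_shift t₀).comp (hF.comp hmul) (hG.comp hext)
  convert key using 1
  · ext ω
    simp only [Function.comp, h, mul_sub]
  · ext ω
    refine hloc _ _ fun t ht ↦ ?_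
    simp [ext, ht, h]

end IsBrownianWithDiffusion

end Brownian

lemma gridPoint_succ (n k : ℕ) : gridPoint n (k + 1) = gridPoint n k + gridPoint n 1 := by
  simp only [gridPoint]
  push_cast
  rw [add_div]

lemma gridPoint_mul (n T : ℕ) : gridPoint n (T * (n + 1)) = T := by
  simp only [gridPoint]
  push_cast
  rw [mul_div_assoc, div_self (by positivity), mul_one]

section Brownian

variable {Ω : Type*} [MeasurableSpace Ω] {P : Measure Ω} {c : ℝ}
  {V : ℝ≥0 → Ω → ℝ}

namespace IsBrownianWithDiffusion

lemma aemeasurable_comp_phaseRun {β : Type*} [MeasurableSpace β]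
    (hV : IsBrownianWithDiffusion c V P) {f : PhaseState → β} (hf : Measurable f) (n k : ℕ) :
    AEMeasurable (fun ω ↦ f (phaseRun (increments (samples (V · ω) n)) k)) P := by
  have h1 : ∀ j, AEMeasurable (fun ω ↦ increments (samples (V · ω) n) j) P := fun j ↦
    (hV.aemeasurable _).sub (hV.aemeasurable _)
  have h2 : AEMeasurable (fun ω ↦ phaseRun (increments (samples (V · ω) n)) k) P := by
    induction k with
    | zero => exact aemeasurable_const
    | succ k ih => exact measurable_phaseStep.comp_aemeasurable ((h1 k).prodMk ih)
  exact hf.comp_aemeasurable h2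

lemma phaseIntegral_moments [IsProbabilityMeasure P] (hV : IsBrownianWithDiffusion c V P) (M : ℕ) (θ : ℕ → ℝ) (n N : ℕ) :
    MemLp (fun ω ↦ phaseIntegral M θ (increments (samples (V · ω) n)) N) 2 P ∧
    ∫ ω, phaseIntegral M θ (increments (samples (V · ω) n)) N ∂P = 0 ∧
    ∫ ω, ‖phaseIntegral M θ (increments (samples (V · ω) n)) N‖ ^ 2 ∂P ≤
      N * (((∏ i ∈ Finset.range M, (1 + |θ i|)) * ∑ i ∈ Finset.range M, |θ i|) ^ 2 *
        (c ^ 2 * gridPoint n 1)) := by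
  have hlaw : ∀ k, HasLaw (fun ω ↦ increments (samples (V · ω) n) k)
      (gaussianReal 0 (‖c‖₊ ^ 2 * gridPoint n 1)) P := by
    intro k
    have := hV.hasLaw_increment (gridPoint n k) (gridPoint n 1)
    simp only [increments, samples, gridPoint_succ n k]
    exact this
  have hmean : ∀ k, ∫ ω, increments (samples (V · ω) n) k ∂P = 0 := fun k ↦ by
    rw [(hlaw k).integral_eq, integral_id_gaussianReal]
  refine integral_sum_mul_of_indepFun (fun k ↦ (hlaw k).hasGaussianLaw.memLp_two) hmean
    (fun k ↦ ?_) (fun k ↦ ?_) (fun k ω ↦ norm_phaseIntegrand_le M θ _) (fun k ↦ ?_) N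
  · have h1 := variance_of_integral_eq_zero (hlaw k).aemeasurable (hmean k)
    rw [(hlaw k).variance_eq, variance_id_gaussianReal] at h1
    rw [← h1]
    simp
  · exact hV.aemeasurable_comp_phaseRun (measurable_phaseIntegrand M θ) n k
  · have := hV.indepFun_shift (gridPoint n k) (F := fun w ↦ w (gridPoint n 1))
      (G := fun w ↦ (phaseIntegrand M θ (phaseRun (increments (samples w n)) k),
        phaseIntegral M θ (increments (samples w n)) k)) (measurable_pi_apply _)
      (((measurable_phaseIntegrand M θ).comp (measurable_phaseRun n k)).prodMk
        (measurable_phaseIntegral M θ n k)) (by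
        intro w w' hww
        have hinc : ∀ j < k, increments (samples w n) j = increments (samples w' n) j := by
          intro j hj
          simp only [increments, samples]
          rw [hww _ (gridPoint_mono n hj), hww _ (gridPoint_mono n hj.le)]
        simp only [phaseRun_congr hinc, phaseIntegral_congr M θ hinc])
    simp only [← gridPoint_succ] at this
    exact this

/-- The stochastic integral `R` is centered, so `E Z - 1 = E (Z - 1 - R)`, and this difference tends
to 0 pathwise while staying bounded in `L²`. -/
lemma tendsto_integral_phaseMart [IsProbabilityMeasure P] (hV : IsBrownianWithDiffusion c V P) (M : ℕ) (θ : ℕ → ℝ)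
    (T : ℕ) : Tendsto (fun n ↦ ∫ ω,
      phaseMart M θ (phaseRun (increments (samples (V · ω) n)) (T * (n + 1))) ∂P) atTop (𝓝 1) := by
  set C := (∏ i ∈ Finset.range M, (1 + |θ i|)) * (1 + ∑ i ∈ Finset.range M, |θ i|)
  set C' := (∏ i ∈ Finset.range M, (1 + |θ i|)) * ∑ i ∈ Finset.range M, |θ i|
  set Z : ℕ → Ω → ℂ := fun n ω ↦
    phaseMart M θ (phaseRun (increments (samples (V · ω) n)) (T * (n + 1))) with hZ
  set R : ℕ → Ω → ℂ := fun n ω ↦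
    phaseIntegral M θ (increments (samples (V · ω) n)) (T * (n + 1)) with hR
  have hZb : ∀ n ω, ‖Z n ω‖ ≤ C := fun n ω ↦
    norm_phaseMart_le M θ _ (phaseRun_invariant _ _).1.1 (phaseRun_invariant _ _).1.2
  have hZm : ∀ n, AEMeasurable (Z n) P := fun n ↦
    hV.aemeasurable_comp_phaseRun (measurable_phaseMart M θ) n _
  have hZ2 : ∀ n, MemLp (fun ω ↦ Z n ω - 1) 2 P := fun n ↦
    (MemLp.of_bound (hZm n).aestronglyMeasurable C
      (Eventually.of_forall (hZb n))).sub (memLp_const 1)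
  have hR2 := fun n ↦ hV.phaseIntegral_moments M θ n (T * (n + 1))
  have hX2 : ∀ n, MemLp (fun ω ↦ Z n ω - 1 - R n ω) 2 P := fun n ↦ (hZ2 n).sub (hR2 n).1
  have hlim : ∀ᵐ ω ∂P, Tendsto (fun n ↦ Z n ω - 1 - R n ω) atTop (𝓝 0) := by
    filter_upwards [hV.cont] with ω hω
    exact tendsto_phaseMart_sub_integral M θ hω T
  have hbound : ∀ n, ∫ ω, ‖Z n ω - 1 - R n ω‖ ^ 2 ∂P ≤
      2 * (C + 1) ^ 2 + 2 * (T * (C' ^ 2 * c ^ 2)) := by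
    intro n
    have i1 : Integrable (fun ω ↦ ‖R n ω‖ ^ 2) P := (hR2 n).1.integrable_norm_pow (by norm_num)
    calc _ ≤ ∫ ω, (2 * (C + 1) ^ 2 + 2 * ‖R n ω‖ ^ 2) ∂P := by
          refine integral_mono ((hX2 n).integrable_norm_pow (by norm_num))
            ((integrable_const _).add (i1.const_mul 2)) fun ω ↦ ?_
          have e1 : ‖Z n ω - 1 - R n ω‖ ≤ (C + 1) + ‖R n ω‖ := by
            refine (norm_sub_le _ _).trans ?_
            gcongr
            refine (norm_sub_le _ _).trans ?_
            rw [norm_one]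
            gcongr
            exact hZb n ω
          simp only
          calc _ ≤ ((C + 1) + ‖R n ω‖) ^ 2 := by gcongr
            _ ≤ _ := by nlinarith [sq_nonneg (C + 1 - ‖R n ω‖)]
      _ = 2 * (C + 1) ^ 2 + 2 * ∫ ω, ‖R n ω‖ ^ 2 ∂P := by
          rw [integral_add (integrable_const _) (i1.const_mul 2), integral_const, integral_const_mul]
          simp
      _ ≤ _ := by
          have := (hR2 n).2.2
          -- There are `T * (n + 1)` steps of variance `c ^ 2 / (n + 1)`, so the bound does not
          -- depend on the mesh.
          have e2 : ((T * (n + 1) : ℕ) : ℝ) * (C' ^ 2 * (c ^ 2 * gridPoint n 1)) =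
              T * (C' ^ 2 * c ^ 2) := by
            simp only [gridPoint]
            push_cast
            field_simp
          rw [e2] at this
          gcongr
  have hmain := tendsto_integral_of_sq_bounded hX2 hbound hlim
  have heq : ∀ n, ∫ ω, Z n ω ∂P = ∫ ω, (Z n ω - 1 - R n ω) ∂P + 1 := by
    intro n
    have i1 : Integrable (Z n) P := Integrable.of_bound (hZm n).aestronglyMeasurable C
      (Eventually.of_forall (hZb n))
    rw [integral_sub ((hZ2 n).integrable (by norm_num)) ((hR2 n).1.integrable (by norm_num)),
      (hR2 n).2.1, integral_sub i1 (integrable_const _)]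
    simp
  change Tendsto (fun n ↦ ∫ ω, Z n ω ∂P) atTop (𝓝 1)
  simp_rw [heq]
  simpa using hmain.add_const 1

end IsBrownianWithDiffusion

/-! ### Joint characteristic function of the gains. -/

/-- The random variables `g` are almost surely the gains of the successive phases of the process
`V`, whose paths are generic. -/
def IsPhaseGains (V : ℝ≥0 → Ω → ℝ) (g : ℕ → Ω → ℝ) (P : Measure Ω) : Prop :=
  ∀ᵐ ω ∂P, IsGenericPath (V · ω) ∧ ∃ τ h, IsSkeleton (V · ω) τ h ∧
    ∀ j, g j ω = phaseSign j * (V (h j) ω - V (τ j) ω)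

/-- The times `τ` and `h` come from pathwise choices; measurability is inherited from the readings
of the automaton, whose almost sure limit is the gain. -/
lemma IsPhaseGains.aemeasurable {g : ℕ → Ω → ℝ} (hg : IsPhaseGains V g P)
    (hV : IsBrownianWithDiffusion c V P) (j : ℕ) : AEMeasurable (g j) P := by
  refine aemeasurable_of_tendsto_metrizable_ae atTop
    (fun n ↦ hV.aemeasurable_comp_phaseRun (measurable_gain j) n (n * (n + 1))) ?_
  filter_upwards [hg] with ω ⟨hω, τ, h, H, hgω⟩
  rw [hgω j]
  obtain ⟨m, hm⟩ := exists_nat_gt (τ (j + 1))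
  refine (H.tendsto_phaseRun hω (φ := fun n ↦ n) tendsto_id hm ?_).2 j (Nat.lt_succ_self j)
  filter_upwards [eventually_ge_atTop m] with n hn
  rw [gridPoint_mul]
  exact_mod_cast hn

/-- The time needed to complete `M` phases is random, so horizon and mesh are refined together.
Almost surely the phases are eventually completed, `phaseMart` then takes the closed form of
`phaseMart_of_le`, and its uniform bound `C` allows dominated convergence. -/
lemma IsPhaseGains.integral_exp [IsProbabilityMeasure P] {g : ℕ → Ω → ℝ} (hg : IsPhaseGains V g P)
    (hV : IsBrownianWithDiffusion c V P) (M : ℕ) (θ : ℕ → ℝ) :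
    (∏ i ∈ Finset.range M, (1 - θ i * Complex.I : ℂ)) *
      ∫ ω, Complex.exp (((∑ i ∈ Finset.range M, θ i * g i ω : ℝ) : ℂ) * Complex.I) ∂P = 1 := by
  set C := (∏ i ∈ Finset.range M, (1 + |θ i|)) * (1 + ∑ i ∈ Finset.range M, |θ i|)
  -- choose the mesh of the grid as a function of the horizon `T`
  have hex : ∀ T : ℕ, ∀ᶠ n in atTop, dist (∫ ω, phaseMart M θ
      (phaseRun (increments (samples (V · ω) n)) (T * (n + 1))) ∂P) 1 < 1 / ((T : ℝ) + 1) :=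
    fun T ↦ (hV.tendsto_integral_phaseMart M θ T).eventually
      (Metric.ball_mem_nhds 1 (by positivity))
  obtain ⟨φ, hφ, hφ'⟩ := extraction_forall_of_eventually hex
  have lim1 : Tendsto (fun T ↦ ∫ ω, phaseMart M θ (phaseRun (increments (samples (V · ω) (φ T)))
      (T * (φ T + 1))) ∂P) atTop (𝓝 1) := by
    rw [tendsto_iff_dist_tendsto_zero]
    exact squeeze_zero (fun _ ↦ dist_nonneg) (fun T ↦ (hφ' T).le)
      tendsto_one_div_add_atTop_nhds_zero_nat
  have lim2 : Tendsto (fun T ↦ ∫ ω, phaseMart M θ (phaseRun (increments (samples (V · ω) (φ T)))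
      (T * (φ T + 1))) ∂P) atTop (𝓝 (∫ ω, (∏ i ∈ Finset.range M, (1 - θ i * Complex.I : ℂ)) *
      Complex.exp (((∑ i ∈ Finset.range M, θ i * g i ω : ℝ) : ℂ) * Complex.I) ∂P)) := by
    refine tendsto_integral_of_dominated_convergence (fun _ ↦ C)
      (fun T ↦ (hV.aemeasurable_comp_phaseRun (measurable_phaseMart M θ) _ _).aestronglyMeasurable)
      (integrable_const _) (fun T ↦ Eventually.of_forall fun ω ↦
        norm_phaseMart_le M θ _ (phaseRun_invariant _ _).1.1 (phaseRun_invariant _ _).1.2) ?_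
    filter_upwards [hg] with ω ⟨hω, τ, h, H, hgω⟩
    obtain ⟨m, hm⟩ := exists_nat_gt (τ M)
    obtain ⟨r1, r2⟩ := H.tendsto_phaseRun hω (φ := φ) (N := fun T ↦ T * (φ T + 1))
      hφ.tendsto_atTop hm (by
        filter_upwards [eventually_ge_atTop m] with n hn
        rw [gridPoint_mul]
        exact_mod_cast hn)
    have lim3 : Tendsto (fun T ↦ ∑ i ∈ Finset.range M, θ i *
        (phaseRun (increments (samples (V · ω) (φ T))) (T * (φ T + 1))).2.2 i) atTop
        (𝓝 (∑ i ∈ Finset.range M, θ i * g i ω)) := by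
      refine tendsto_finsetSum _ fun i hi ↦ Tendsto.const_mul _ ?_
      rw [hgω i]
      exact r2 i (Finset.mem_range.1 hi)
    have hcont : Continuous (fun x : ℝ ↦ (∏ i ∈ Finset.range M, (1 - θ i * Complex.I : ℂ)) *
      Complex.exp ((x : ℂ) * Complex.I)) := by fun_prop
    refine ((hcont.tendsto _).comp lim3).congr' ?_
    filter_upwards [r1] with T hT
    rw [phaseMart_of_le hT]
    rfl
  rw [← integral_const_mul]
  exact tendsto_nhds_unique lim2 lim1

end Brownian

/-! ### Almost every Brownian path is generic. -/

/-- A countable dense family of points of the interval `[p, q]`. -/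
noncomputable def intervalPoint (p q : ℝ≥0) (i : ℕ × ℕ) : ℝ≥0 :=
  p + (q - p) * min 1 (gridPoint i.1 i.2)

/-- The infimum of a path over a countable dense subset of `[p, q]`. -/
noncomputable def intervalInf (p q : ℝ≥0) (w : ℝ≥0 → ℝ) : ℝ := ⨅ i, w (intervalPoint p q i)

lemma intervalPoint_mem {p q : ℝ≥0} (hpq : p ≤ q) (i : ℕ × ℕ) :
    intervalPoint p q i ∈ Icc p q := by
  refine ⟨le_self_add, ?_⟩
  calc p + (q - p) * min 1 (gridPoint i.1 i.2) ≤ p + (q - p) * 1 := by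
        gcongr; exact min_le_left _ _
    _ = q := by rw [mul_one, add_tsub_cancel_of_le hpq]

lemma intervalInf_eq {p q m : ℝ≥0} {w : ℝ≥0 → ℝ} (hw : Continuous w) (hm : m ∈ Icc p q)
    (hmin : ∀ x ∈ Icc p q, w m ≤ w x) : intervalInf p q w = w m := by
  have hpq : p ≤ q := hm.1.trans hm.2
  have hb : BddBelow (range fun i ↦ w (intervalPoint p q i)) :=
    ⟨w m, by rintro _ ⟨i, rfl⟩; exact hmin _ (intervalPoint_mem hpq i)⟩
  refine le_antisymm ?_ (le_ciInf fun i ↦ hmin _ (intervalPoint_mem hpq i))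
  obtain ⟨u, hu1, hu⟩ : ∃ u : ℝ≥0, u ≤ 1 ∧ p + (q - p) * u = m := by
    rcases hpq.eq_or_lt with rfl | hlt
    · exact ⟨0, zero_le, by simpa using le_antisymm hm.1 hm.2⟩
    · have hpos : 0 < q - p := tsub_pos_of_lt hlt
      refine ⟨(m - p) / (q - p), ?_, ?_⟩
      · rw [div_le_one hpos]
        exact tsub_le_tsub_right hm.2 p
      · rw [mul_div_cancel₀ _ hpos.ne', add_tsub_cancel_of_le hm.1]
  have hlim : Tendsto (fun n : ℕ ↦ w (intervalPoint p q (n, ⌈u * ((n : ℝ≥0) + 1)⌉₊))) atTop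
      (𝓝 (w m)) := by
    refine (hw.tendsto m).comp ?_
    have := ((tendsto_const_nhds (x := (1 : ℝ≥0))).min (tendsto_gridPoint_ceil u)).const_mul (q - p)
    have := this.const_add p
    rwa [min_eq_right hu1, hu] at this
  exact le_of_tendsto_of_tendsto' tendsto_const_nhds hlim fun n ↦ ciInf_le hb _

lemma measurable_intervalInf (p q : ℝ≥0) : Measurable (intervalInf p q) :=
  Measurable.iInf fun _ ↦ measurable_pi_apply _

lemma intervalInf_congr {p q : ℝ≥0} (hpq : p ≤ q) {w w' : ℝ≥0 → ℝ}
    (h : ∀ t ≤ q, w t = w' t) : intervalInf p q w = intervalInf p q w' :=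
  iInf_congr fun i ↦ h _ (intervalPoint_mem hpq i).2

/-- By Fubini: for each value `y` of `Y`, the event requires `X` to hit the single point `a - y`. -/
lemma ae_add_ne_of_indepFun {Ω : Type*} [MeasurableSpace Ω] {P : Measure Ω}
    [IsProbabilityMeasure P] {X Y : Ω → ℝ} (hX : AEMeasurable X P) (hY : AEMeasurable Y P)
    (hXY : IndepFun X Y P) (hat : ∀ a, ∀ᵐ ω ∂P, X ω ≠ a) (a : ℝ) : ∀ᵐ ω ∂P, X ω + Y ω ≠ a := by
  have hmap := (indepFun_iff_map_prod_eq_prod_map_map hY hX).1 hXY.symm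
  have hs : MeasurableSet {q : ℝ × ℝ | q.2 + q.1 = a} :=
    measurableSet_eq_fun (by fun_prop) measurable_const
  have hnull : P.map (fun ω ↦ (Y ω, X ω)) {q : ℝ × ℝ | q.2 + q.1 = a} = 0 := by
    rw [hmap, Measure.measure_prod_null hs]
    refine Eventually.of_forall fun y ↦ ?_
    have : (Prod.mk y ⁻¹' {q : ℝ × ℝ | q.2 + q.1 = a}) = {a - y} := by
      ext x
      simp [eq_sub_iff_add_eq]
    change P.map X (Prod.mk y ⁻¹' {q : ℝ × ℝ | q.2 + q.1 = a}) = 0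
    rw [this, Measure.map_apply_of_aemeasurable hX (MeasurableSet.singleton _)]
    have h := hat (a - y)
    rw [ae_iff] at h
    simpa [preimage] using h
  rw [Measure.map_apply_of_aemeasurable (hY.prodMk hX) hs] at hnull
  rw [ae_iff]
  simpa [preimage] using hnull

section Brownian

variable {Ω : Type*} [MeasurableSpace Ω] {P : Measure Ω} {c : ℝ} {V : ℝ≥0 → Ω → ℝ}

namespace IsBrownianWithDiffusion

lemma aemeasurable_comp_intervalInf (hV : IsBrownianWithDiffusion c V P) (a : ℝ) (p q : ℝ≥0) :
    AEMeasurable (fun ω ↦ intervalInf p q (fun x ↦ a * V x ω)) P :=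
  AEMeasurable.iInf fun _ ↦ (hV.aemeasurable _).const_mul a

lemma ae_increment_ne (hV : IsBrownianWithDiffusion c V P) (hc : c ≠ 0) (t₀ : ℝ≥0) {t : ℝ≥0}
    (ht : t ≠ 0) (a : ℝ) : ∀ᵐ ω ∂P, V (t₀ + t) ω - V t₀ ω ≠ a := by
  have hlaw := hV.hasLaw_increment t₀ t
  have hne : (‖c‖₊ ^ 2 * t : ℝ≥0) ≠ 0 := by
    exact mul_ne_zero (pow_ne_zero 2 (nnnorm_ne_zero_iff.2 hc)) ht
  have := nullSingletonClass_gaussianReal (μ := 0) hne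
  rw [hlaw.ae_iff (p := fun x ↦ x ≠ a)
    (measurableSet_setOfPred.1 (measurableSet_eq.compl)), ae_iff]
  simp

/-- Extremal values of the process on two disjoint intervals almost surely do not differ by a given
constant. -/
lemma ae_extremum_sub_ne [IsProbabilityMeasure P] (hV : IsBrownianWithDiffusion c V P)
    (hc : c ≠ 0) {p q r s : ℝ≥0} (hpq : p ≤ q) (hqr : q < r) (hrs : r ≤ s) {a b : ℝ}
    (ha : a * a = 1) (hb : b * b = 1) (k : ℝ) :
    ∀ᵐ ω ∂P, ∀ m ∈ Icc p q, ∀ m' ∈ Icc r s, (∀ x ∈ Icc p q, b * V m ω ≤ b * V x ω) →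
      (∀ x ∈ Icc r s, a * V m' ω ≤ a * V x ω) → V m' ω - V m ω ≠ k := by
  -- The difference of the extrema splits into the increment over `[q, r]`, a functional `F'` of the
  -- path after `r`, and a functional `G` of the path before `q`. The increment is a nondegenerate
  -- Gaussian independent of the rest, so the sum has no atom. The signs `a` and `b` select minima
  -- or maxima.
  have hd : r - q ≠ 0 := (tsub_pos_of_lt hqr).ne'
  have hU := hV.shift q
  have hU' := hU.shift (r - q)
  -- the increment over `[q, r]` and the later infimum
  let F' : (ℝ≥0 → ℝ) → ℝ := fun u ↦ a * intervalInf 0 (s - r) (fun x ↦ a * u x)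
  have hF' : Measurable F' :=
    ((measurable_intervalInf 0 (s - r)).comp
      (measurable_pi_lambda _ fun x ↦ by fun_prop)).const_mul a
  let F : (ℝ≥0 → ℝ) → ℝ := fun u ↦ u (r - q) + F' (fun x ↦ u (r - q + x) - u (r - q))
  have hF : Measurable F :=
    (measurable_pi_apply _).add (hF'.comp (measurable_pi_lambda _ fun x ↦ by fun_prop))
  let G : (ℝ≥0 → ℝ) → ℝ := fun w ↦ w q - b * intervalInf p q (fun x ↦ b * w x)
  have hG : Measurable G :=
    (measurable_pi_apply _).sub (((measurable_intervalInf p q).comp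
      (measurable_pi_lambda _ fun x ↦ by fun_prop)).const_mul b)
  have hind1 := hU.indepFun_shift (r - q) (F := F') (G := fun u ↦ u (r - q)) hF'
    (measurable_pi_apply _) (fun w w' h ↦ h _ le_rfl)
  have hind2 := hV.indepFun_shift q (F := F) (G := G) hF hG (fun w w' h ↦ by
    simp only [G]
    rw [h q le_rfl, intervalInf_congr hpq (w := fun x ↦ b * w x) (w' := fun x ↦ b * w' x)
      (fun t ht ↦ by simp only [h t ht])])
  have hat : ∀ y, ∀ᵐ ω ∂P, F (fun t ↦ V (q + t) ω - V q ω) ≠ y := fun y ↦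
    ae_add_ne_of_indepFun (hU.aemeasurable (r - q))
      ((hU'.aemeasurable_comp_intervalInf a 0 (s - r)).const_mul a) hind1.symm
      (hV.ae_increment_ne hc q hd) y
  have hFm : AEMeasurable (fun ω ↦ F (fun t ↦ V (q + t) ω - V q ω)) P :=
    (hU.aemeasurable (r - q)).add ((hU'.aemeasurable_comp_intervalInf a 0 (s - r)).const_mul a)
  have hGm : AEMeasurable (fun ω ↦ G (V · ω)) P :=
    (hV.aemeasurable q).sub ((hV.aemeasurable_comp_intervalInf b p q).const_mul b)
  filter_upwards [ae_add_ne_of_indepFun hFm hGm hind2 hat k, hV.cont] with ω hω hcont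
  intro m hm m' hm' hmin hmin'
  have e1 : intervalInf p q (fun x ↦ b * V x ω) = b * V m ω :=
    intervalInf_eq (by fun_prop) hm hmin
  have hqd : q + (r - q) = r := add_tsub_cancel_of_le hqr.le
  have e2 : intervalInf 0 (s - r) (fun x ↦ a * (V (q + (r - q + x)) ω - V q ω -
      (V (q + (r - q)) ω - V q ω))) = a * (V m' ω - V r ω) := by
    rw [intervalInf_eq (m := m' - r) (by fun_prop)
      ⟨zero_le, tsub_le_tsub_right hm'.2 r⟩ ?_]
    · rw [← add_assoc, hqd, add_tsub_cancel_of_le hm'.1]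
      ring
    · intro x hx
      rw [← add_assoc, ← add_assoc, hqd, add_tsub_cancel_of_le hm'.1]
      have hx' : r + x ∈ Icc r s := by
        refine ⟨le_self_add, ?_⟩
        calc r + x ≤ r + (s - r) := by gcongr; exact hx.2
          _ = s := add_tsub_cancel_of_le hrs
      have := hmin' _ hx'
      linarith
  contrapose! hω
  rw [hqd] at e2
  simp only [F, F', G, e1, e2, hqd]
  rw [← mul_assoc, ha, ← mul_assoc, hb]
  linarith

/-- Second Borel–Cantelli lemma: the unit increments are independent, and each is at least 1 with
the same positive probability. -/
lemma ae_exists_gt [IsProbabilityMeasure P] (hV : IsBrownianWithDiffusion c V P) (hc : c ≠ 0) :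
    ∀ᵐ ω ∂P, ∃ᶠ n : ℕ in atTop, V n ω + 1 ≤ V (n + 1) ω := by
  have hlaw : ∀ n : ℕ, HasLaw (fun ω ↦ V ((n : ℝ≥0) + 1) ω - V n ω)
      (gaussianReal 0 (‖c‖₊ ^ 2 * 1)) P := fun n ↦ hV.hasLaw_increment n 1
  have hne : (‖c‖₊ ^ 2 * 1 : ℝ≥0) ≠ 0 := by
    exact mul_ne_zero (pow_ne_zero 2 (nnnorm_ne_zero_iff.2 hc)) one_ne_zero
  have hind : iIndepFun (fun (n : ℕ) ω ↦ V ((n : ℝ≥0) + 1) ω - V n ω) P := by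
    obtain ⟨B, hB, h⟩ := hV
    have := (hB.toIsPreBrownianReal.hasIndepIncrements.nat
      (t := fun n : ℕ ↦ (n : ℝ≥0)) Nat.mono_cast).comp (fun _ x ↦ c * x) (by fun_prop)
    convert this using 2 with n
    ext ω
    simp [h, mul_sub]
  have hm := fun n ↦ (hlaw n).aemeasurable
  have hind' := hind.congr fun n ↦ (hm n).ae_eq_mk
  let A : ℕ → Set Ω := fun n ↦ (hm n).mk _ ⁻¹' (Ici 1)
  have hA : ∀ n, MeasurableSet (A n) := fun n ↦ (hm n).measurable_mk measurableSet_Ici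
  have hindA : iIndepSet A P := by
    rw [iIndepSet_iff_meas_biInter hA]
    intro S
    exact hind'.measure_inter_preimage_eq_mul S (fun _ _ ↦ measurableSet_Ici)
  have hpos : gaussianReal 0 (‖c‖₊ ^ 2 * 1) (Ici 1) ≠ 0 := by
    intro h
    have := gaussianReal_absolutelyContinuous' 0 hne h
    simp at this
  have hPA : ∀ n, P (A n) = gaussianReal 0 (‖c‖₊ ^ 2 * 1) (Ici 1) := by
    intro n
    rw [← (hlaw n).map_eq, Measure.map_apply_of_aemeasurable (hm n) measurableSet_Ici]
    refine measure_congr ?_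
    filter_upwards [(hm n).ae_eq_mk] with ω hω
    change ((hm n).mk _ ω ∈ Ici (1 : ℝ)) = (_ ∈ Ici (1 : ℝ))
    rw [← hω]
  have hlim : P (limsup A atTop) = 1 := by
    refine measure_limsup_eq_one hA hindA ?_
    simp only [hPA]
    exact ENNReal.tsum_const_eq_top_of_ne_zero hpos
  have hae : ∀ᵐ ω ∂P, ω ∈ limsup A atTop := by
    rw [← prob_compl_eq_zero_iff (MeasurableSet.measurableSet_limsup hA)] at hlim
    exact hlim
  filter_upwards [hae, ae_all_iff.2 fun n ↦ (hm n).ae_eq_mk] with ω h1 h2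
  rw [mem_limsup_iff_frequently_mem] at h1
  refine h1.mono fun n hn ↦ ?_
  have : 1 ≤ (hm n).mk _ ω := hn
  rw [← h2 n] at this
  linarith

end IsBrownianWithDiffusion

/-- Local minima become minima over intervals with endpoints in a countable set. The point 0 is
added to `D` because a minimum at the origin has no room on its left. -/
lemma exists_Icc_forall_le {D : Set ℝ≥0} (hD : Dense D) {v : ℝ≥0 → ℝ} {m l u : ℝ≥0}
    (hm : IsLocalMin v m) (hl : l < m ∨ m = 0 ∧ l = 0) (hu : m < u) :
    ∃ p ∈ insert 0 D, ∃ q ∈ insert 0 D, l ≤ p ∧ p ≤ m ∧ m ≤ q ∧ q < u ∧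
      ∀ x ∈ Icc p q, v m ≤ v x := by
  obtain ⟨q, hq, hmq, hqu, hq'⟩ : ∃ q ∈ insert 0 D, m ≤ q ∧ q < u ∧
      ∀ x ∈ Icc m q, v m ≤ v x := by
    obtain ⟨u', hu', hsub⟩ := exists_Ico_subset_of_mem_nhds hm ⟨u, hu⟩
    obtain ⟨q, hq, hq1, hq2⟩ := hD.exists_between (lt_min hu' hu)
    exact ⟨q, Or.inr hq, hq1.le, hq2.trans_le (min_le_right _ _), fun x hx ↦
      hsub ⟨hx.1, hx.2.trans_lt (hq2.trans_le (min_le_left _ _))⟩⟩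
  obtain ⟨p, hp, hlp, hpm, hp'⟩ : ∃ p ∈ insert 0 D, l ≤ p ∧ p ≤ m ∧
      ∀ x ∈ Icc p m, v m ≤ v x := by
    rcases hl with hl | ⟨rfl, rfl⟩
    · obtain ⟨l', hl', hsub⟩ := exists_Ioc_subset_of_mem_nhds hm ⟨l, hl⟩
      obtain ⟨p, hp, hp1, hp2⟩ := hD.exists_between (max_lt hl' hl)
      exact ⟨p, Or.inr hp, ((le_max_right _ _).trans_lt hp1).le, hp2.le, fun x hx ↦
        hsub ⟨((le_max_left _ _).trans_lt hp1).trans_le hx.1, hx.2⟩⟩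
    · exact ⟨0, mem_insert _ _, le_rfl, le_rfl, fun x hx ↦ by
        rw [le_antisymm hx.2 hx.1]⟩
  refine ⟨p, hp, q, hq, hlp, hpm, hmq, hqu, fun x hx ↦ ?_⟩
  rcases le_total x m with h | h
  · exact hp' x ⟨hx.1, h⟩
  · exact hq' x ⟨h, hx.2⟩

namespace IsBrownianWithDiffusion

lemma ae_localExtr_sub_ne [IsProbabilityMeasure P] (hV : IsBrownianWithDiffusion c V P)
    (hc : c ≠ 0) {a b : ℝ} (ha : a * a = 1) (hb : b * b = 1) (k : ℝ) :
    ∀ᵐ ω ∂P, ∀ m m', m < m' → IsLocalMin (fun x ↦ b * V x ω) m →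
      IsLocalMin (fun x ↦ a * V x ω) m' → V m' ω - V m ω ≠ k := by
  obtain ⟨D, hDc, hD⟩ := TopologicalSpace.exists_countable_dense ℝ≥0
  have hDc' : (insert 0 D).Countable := hDc.insert 0
  have : Countable ↥(insert 0 D) := hDc'.to_subtype
  have hall : ∀ᵐ ω ∂P, ∀ p q r s : ↥(insert 0 D), p.1 ≤ q.1 → q.1 < r.1 → r.1 ≤ s.1 →
      ∀ m ∈ Icc p.1 q.1, ∀ m' ∈ Icc r.1 s.1, (∀ x ∈ Icc p.1 q.1, b * V m ω ≤ b * V x ω) →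
      (∀ x ∈ Icc r.1 s.1, a * V m' ω ≤ a * V x ω) → V m' ω - V m ω ≠ k := by
    simp only [ae_all_iff]
    intro p q r s h1 h2 h3
    have := hV.ae_extremum_sub_ne hc h1 h2 h3 ha hb k
    simpa only [eventually_all] using this
  filter_upwards [hall] with ω hω m m' hmm hm hm'
  obtain ⟨x, hx1, hx2⟩ := exists_between hmm
  obtain ⟨p, hp, q, hq, -, h1, h2, h3, h4⟩ := exists_Icc_forall_le hD hm (l := 0)
    (by rcases eq_or_ne m 0 with h | h
        · exact Or.inr ⟨h, rfl⟩
        · exact Or.inl (pos_of_ne_zero h)) hx1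
  obtain ⟨r, hr, s, hs, e0, e1, e2, -, e4⟩ := exists_Icc_forall_le hD hm' (Or.inl hx2)
    (lt_add_one m')
  exact hω ⟨p, hp⟩ ⟨q, hq⟩ ⟨r, hr⟩ ⟨s, hs⟩ (h1.trans h2) (h3.trans_le e0) (e1.trans e2) m ⟨h1, h2⟩
    m' ⟨e1, e2⟩ h4 e4

/-- Almost every path of a Brownian motion is generic. -/
lemma ae_isGenericPath [IsProbabilityMeasure P] (hV : IsBrownianWithDiffusion c V P)
    (hc : c ≠ 0) : ∀ᵐ ω ∂P, IsGenericPath (V · ω) := by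
  have hone : (1 : ℝ) * 1 = 1 := one_mul 1
  have hneg : (-1 : ℝ) * (-1) = 1 := by norm_num
  -- The three instances cover two minima at equal height, a minimum followed by a maximum 1 higher,
  -- and a maximum followed by a minimum 1 lower.
  filter_upwards [hV.cont, hV.ae_localExtr_sub_ne hc hone hone 0,
    hV.ae_localExtr_sub_ne hc hneg hone 1, hV.ae_localExtr_sub_ne hc hone hneg (-1),
    hV.ae_exists_gt hc, hV.neg.ae_exists_gt hc] with ω h1 h2 h3 h4 h5 h6
  simp only [one_mul, neg_mul] at h2 h3 h4
  refine ⟨h1, fun m m' hmm hm hm' heq ↦ h2 m m' hmm hm hm' ?_, fun m h hm hh heq ↦ ?_,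
    fun a ↦ ?_, fun a ↦ ?_⟩
  · rw [heq, sub_self]
  · rcases lt_trichotomy m h with hlt | rfl | hlt
    · exact h3 m h hlt hm hh.neg (by rw [heq]; ring)
    · linarith
    · exact h4 h m hlt hh.neg hm (by rw [heq]; ring)
  · obtain ⟨n, hn, hna⟩ := (h5.and_eventually
      (tendsto_natCast_atTop_atTop.eventually_ge_atTop a)).exists
    exact ⟨n, n + 1, hna, le_self_add, hn⟩
  · obtain ⟨n, hn, hna⟩ := (h6.and_eventually
      (tendsto_natCast_atTop_atTop.eventually_ge_atTop a)).exists
    exact ⟨n, n + 1, hna, le_self_add, by linarith⟩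

end IsBrownianWithDiffusion

end Brownian

/-! ### The hypoexponential density and characteristic functions. -/

/-- The coefficients of `fGamma`, for the index `γ = n + 1`. -/
noncomputable def hypoCoeff (n i : ℕ) : ℝ :=
  (-1 : ℝ) ^ (n - i) * (i : ℝ) ^ (n - 1) / ((Nat.factorial i : ℝ) * (Nat.factorial (n - i) : ℝ))

lemma fGamma_eq (n : ℕ) (x : ℝ) :
    fGamma (n + 1) x = ∑ i ∈ Finset.Icc 1 n, hypoCoeff n i * Real.exp (-x / i) := rfl

lemma hypoCoeff_succ {n i : ℕ} (hn : 1 ≤ n) (hi : i ≤ n) :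
    hypoCoeff (n + 1) i * ((i : ℝ) - (n + 1)) = hypoCoeff n i * i := by
  obtain ⟨k, rfl⟩ := Nat.exists_eq_add_of_le hi
  have h1 : i + k + 1 - i = k + 1 := by omega
  have h2 : i + k - i = k := by omega
  have h3 : i + k + 1 - 1 = (i + k - 1) + 1 := by omega
  rw [hypoCoeff, hypoCoeff, h1, h2, h3, pow_succ, pow_succ, Nat.factorial_succ]
  have hf1 : (Nat.factorial i : ℝ) ≠ 0 := by positivity
  have hf2 : (Nat.factorial k : ℝ) ≠ 0 := by positivity
  push_cast
  field_simp
  ring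

/-- Up to the factor `(n + 1)!`, this is the finite difference of order `n + 1` of the monomial of
degree `n` at 0. The term `i = 0` vanishes since `n ≥ 1`. -/
lemma sum_hypoCoeff_succ {n : ℕ} (hn : 1 ≤ n) :
    ∑ i ∈ Finset.Icc 1 (n + 1), hypoCoeff (n + 1) i = 0 := by
  have h := congrFun (fwdDiff_iter_pow_eq_zero_of_lt (R := ℝ) (Nat.lt_succ_self n)) 0
  rw [fwdDiff_iter_eq_sum_shift, Pi.zero_apply] at h
  have h2 : ∑ i ∈ Finset.range (n + 1 + 1), (Nat.factorial (n + 1) : ℝ) * hypoCoeff (n + 1) i = 0 := by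
    rw [← h]
    refine Finset.sum_congr rfl fun i hi ↦ ?_
    have hi' : i ≤ n + 1 := by rw [Finset.mem_range] at hi; omega
    rw [hypoCoeff, ← Nat.choose_mul_factorial_mul_factorial hi']
    have hf1 : (Nat.factorial i : ℝ) ≠ 0 := by positivity
    have hf2 : (Nat.factorial (n + 1 - i) : ℝ) ≠ 0 := by positivity
    simp only [zsmul_eq_mul, nsmul_eq_mul, zero_add, mul_one, Nat.add_sub_cancel]
    push_cast
    field_simp
  rw [← Finset.mul_sum, mul_eq_zero] at h2
  have h3 := h2.resolve_left (by positivity)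
  rw [Finset.range_eq_Ico, Finset.sum_eq_sum_Ico_succ_bot (by omega)] at h3
  have h4 : hypoCoeff (n + 1) 0 = 0 := by
    simp [hypoCoeff, show n ≠ 0 by omega]
  rw [h4, zero_add] at h3
  exact h3

/-- Each function arises from the previous one by convolution with an exponential law of mean `n +
1`. In differential form, `exp (y / (n + 1)) * fGamma (n + 2) y` vanishes at 0 and has derivative
`exp (y / (n + 1)) * fGamma (n + 1) y / (n + 1)`, which is nonnegative by induction. -/
lemma fGamma_nonneg (n : ℕ) (hn : 1 ≤ n) : ∀ x, 0 ≤ x → 0 ≤ fGamma (n + 1) x := by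
  induction n, hn using Nat.le_induction with
  | base =>
    intro x _
    rw [fGamma_eq]
    simp [hypoCoeff, Real.exp_nonneg]
  | succ n hn ih =>
    intro x hx
    let G : ℝ → ℝ := fun y ↦ Real.exp (y / (n + 1)) * fGamma (n + 1 + 1) y
    have hderiv : ∀ y, HasDerivAt G (Real.exp (y / (n + 1)) * (fGamma (n + 1) y / (n + 1))) y := by
      intro y
      have h1 : HasDerivAt (fun y : ℝ ↦ Real.exp (y / (n + 1)))
          (Real.exp (y / (n + 1)) * (1 / (n + 1))) y := ((hasDerivAt_id y).div_const _).exp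
      have h2 : HasDerivAt (fun y : ℝ ↦ fGamma (n + 1 + 1) y)
          (∑ i ∈ Finset.Icc 1 (n + 1), hypoCoeff (n + 1) i * (Real.exp (-y / i) * (-1 / i))) y := by
        simp only [fGamma_eq]
        refine HasDerivAt.fun_sum fun i _ ↦ ?_
        exact (((hasDerivAt_id y).neg.div_const _).exp).const_mul _
      refine (h1.mul h2).congr_deriv ?_
      symm
      rw [mul_assoc, ← mul_add]
      congr 1
      rw [fGamma_eq, fGamma_eq, Finset.mul_sum, ← Finset.sum_add_distrib,
        ← Finset.insert_Icc_right_eq_Icc_add_one (by omega), Finset.sum_insert (by simp),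
        Finset.sum_div]
      have hlast : 1 / ((n : ℝ) + 1) * (hypoCoeff (n + 1) (n + 1) *
          Real.exp (-y / ((n + 1 : ℕ) : ℝ))) + hypoCoeff (n + 1) (n + 1) *
          (Real.exp (-y / ((n + 1 : ℕ) : ℝ)) * (-1 / ((n + 1 : ℕ) : ℝ))) = 0 := by
        push_cast
        ring
      rw [hlast, zero_add]
      refine Finset.sum_congr rfl fun i hi ↦ ?_
      obtain ⟨hi1, hi2⟩ := Finset.mem_Icc.1 hi
      have hi0 : (i : ℝ) ≠ 0 := by positivity
      have h := hypoCoeff_succ hn hi2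
      have : hypoCoeff n i = hypoCoeff (n + 1) i * ((i : ℝ) - (n + 1)) / i := by
        rw [h]; field_simp
      rw [this]
      field_simp
      ring
    have hmono : MonotoneOn G (Ici 0) := by
      refine monotoneOn_of_deriv_nonneg (convex_Ici 0)
        (fun y _ ↦ (hderiv y).continuousAt.continuousWithinAt)
        (fun y _ ↦ (hderiv y).differentiableAt.differentiableWithinAt) fun y hy ↦ ?_
      rw [interior_Ici] at hy
      rw [(hderiv y).deriv]
      have := ih y (le_of_lt hy)
      positivity
    have h0 : G 0 = 0 := by
      simp only [G, fGamma_eq]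
      simp [sum_hypoCoeff_succ hn]
    have h1 := hmono (mem_Ici.2 le_rfl) (mem_Ici.2 hx) hx
    rw [h0] at h1
    exact nonneg_of_mul_nonneg_right h1 (Real.exp_pos _)

lemma one_sub_mul_I_ne_zero (a θ : ℝ) : (1 - a * (θ * Complex.I) : ℂ) ≠ 0 := by
  intro h
  have := congrArg Complex.re h
  simp at this

/-- Partial fractions for `∏ 1 / (1 - j z)`. In the induction, `(1 - (n+1) z) i / (1 - i z) = (n+1)
+ (i - (n+1)) / (1 - i z)`; the constants cancel by `sum_hypoCoeff_succ`, and `hypoCoeff_succ`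
identifies the rest with the previous case. -/
lemma sum_hypoCoeff_div (n : ℕ) (hn : 1 ≤ n) (θ : ℝ) :
    (∏ j ∈ Finset.Icc 1 n, (1 - j * (θ * Complex.I) : ℂ)) *
      ∑ i ∈ Finset.Icc 1 n, (hypoCoeff n i : ℂ) * (i / (1 - i * (θ * Complex.I))) = 1 := by
  have hne : ∀ i : ℕ, (1 - i * (θ * Complex.I) : ℂ) ≠ 0 := fun i ↦ by
    exact_mod_cast one_sub_mul_I_ne_zero i θ
  induction n, hn using Nat.le_induction with
  | base =>
    have := hne 1
    simp [hypoCoeff] at this ⊢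
    field_simp
  | succ n hn ih =>
    set z : ℂ := θ * Complex.I
    refine Eq.trans ?_ ih
    have hprod : ∏ j ∈ Finset.Icc 1 (n + 1), (1 - j * z) =
        (∏ j ∈ Finset.Icc 1 n, (1 - j * z)) * (1 - ((n + 1 : ℕ) : ℂ) * z) := by
      rw [← Finset.insert_Icc_right_eq_Icc_add_one (by omega), Finset.prod_insert (by simp), mul_comm]
    rw [hprod, mul_assoc]
    congr 1
    have hterm : ∀ i ∈ Finset.Icc 1 (n + 1), (1 - ((n + 1 : ℕ) : ℂ) * z) *
        ((hypoCoeff (n + 1) i : ℂ) * (i / (1 - i * z))) = (n + 1) * (hypoCoeff (n + 1) i : ℂ) +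
        ((hypoCoeff (n + 1) i * ((i : ℝ) - (n + 1)) : ℝ) : ℂ) / (1 - i * z) := by
      intro i _
      have := hne i
      rw [← mul_div_assoc, ← mul_div_assoc, div_eq_iff this, add_mul, div_mul_cancel₀ _ this]
      push_cast
      ring
    rw [Finset.mul_sum, Finset.sum_congr rfl hterm, Finset.sum_add_distrib, ← Finset.mul_sum,
      ← Complex.ofReal_sum, sum_hypoCoeff_succ hn, Complex.ofReal_zero, mul_zero, zero_add,
      ← Finset.insert_Icc_right_eq_Icc_add_one (by omega), Finset.sum_insert (by simp)]
    have hlast : ((hypoCoeff (n + 1) (n + 1) * (((n + 1 : ℕ) : ℝ) - (n + 1)) : ℝ) : ℂ) = 0 := by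
      push_cast; ring
    rw [hlast, zero_div, zero_add]
    refine Finset.sum_congr rfl fun i hi ↦ ?_
    rw [hypoCoeff_succ hn (Finset.mem_Icc.1 hi).2]
    push_cast
    ring

/-- The measure with density `f` on `[0, ∞)`. -/
noncomputable def measureOfDensity (f : ℝ → ℝ) : Measure ℝ :=
  volume.withDensity fun x : ℝ ↦ if 0 ≤ x then ENNReal.ofReal (f x) else 0

lemma measurable_density {f : ℝ → ℝ} (hf : Measurable f) :
    Measurable (fun x : ℝ ↦ if 0 ≤ x then ENNReal.ofReal (f x) else 0) :=
  Measurable.ite measurableSet_Ici hf.ennreal_ofReal measurable_const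

lemma charFun_measureOfDensity {f : ℝ → ℝ} (hf : Measurable f) (h0 : ∀ x, 0 ≤ x → 0 ≤ f x)
    (θ : ℝ) : charFun (measureOfDensity f) θ =
      ∫ x in Ioi 0, (f x : ℂ) * Complex.exp ((θ * Complex.I) * x) := by
  rw [charFun_apply_real, measureOfDensity,
    integral_withDensity_eq_integral_toReal_smul (measurable_density hf)
      (Eventually.of_forall fun x ↦ by split_ifs <;> simp),
    ← integral_Ici_eq_integral_Ioi, ← integral_indicator measurableSet_Ici]
  congr 1 with x
  by_cases hx : 0 ≤ x
  · rw [indicator_of_mem (mem_Ici.2 hx), if_pos hx, ENNReal.toReal_ofReal (h0 x hx)]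
    simp only [Complex.real_smul]
    congr 2
    ring
  · rw [indicator_of_notMem (by simpa using hx), if_neg hx]
    simp

lemma isFiniteMeasure_measureOfDensity {f : ℝ → ℝ} (hf : IntegrableOn f (Ici 0)) :
    IsFiniteMeasure (measureOfDensity f) := by
  refine isFiniteMeasure_withDensity ?_
  have h := ((integrable_indicator_iff measurableSet_Ici).2 hf).lintegral_lt_top
  refine (lt_of_le_of_lt (lintegral_mono fun x ↦ ?_) h).ne
  by_cases hx : 0 ≤ x
  · rw [if_pos hx, indicator_of_mem (mem_Ici.2 hx)]
  · rw [if_neg hx]; exact zero_le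

lemma integral_exp_mul_exp {a : ℝ} (ha : 0 < a) (θ : ℝ) :
    ∫ x in Ioi (0 : ℝ), ((Real.exp (-(a * x)) : ℝ) : ℂ) * Complex.exp ((θ * Complex.I) * x) =
      1 / (a - θ * Complex.I) ∧
    IntegrableOn (fun x : ℝ ↦ ((Real.exp (-(a * x)) : ℝ) : ℂ) *
      Complex.exp ((θ * Complex.I) * x)) (Ioi 0) := by
  have heq : ∀ x : ℝ, ((Real.exp (-(a * x)) : ℝ) : ℂ) * Complex.exp ((θ * Complex.I) * x) =
      Complex.exp ((-a + θ * Complex.I) * x) := by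
    intro x
    push_cast
    rw [← Complex.exp_add]
    congr 1
    ring
  have hre : (-a + θ * Complex.I : ℂ).re < 0 := by simpa using ha
  simp only [heq]
  refine ⟨?_, integrableOn_exp_mul_complex_Ioi hre 0⟩
  rw [integral_exp_mul_complex_Ioi hre]
  simp only [Complex.ofReal_zero, mul_zero, Complex.exp_zero]
  rw [show (-a + θ * Complex.I : ℂ) = -(a - θ * Complex.I) by ring, neg_div_neg_eq]

lemma expMeasure_eq (r : ℝ) : expMeasure r = measureOfDensity fun x ↦ r * Real.exp (-(r * x)) := by
  rw [measureOfDensity]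
  change volume.withDensity (exponentialPDF r) = _
  congr 1 with x
  rw [exponentialPDF_eq]
  split_ifs <;> simp

lemma charFun_expMeasure {m : ℝ} (hm : 0 < m) (θ : ℝ) :
    charFun (expMeasure (1 / m)) θ = 1 / (1 - (θ * m : ℝ) * Complex.I) := by
  have hne := one_sub_mul_I_ne_zero m θ
  have hm' : (m : ℂ) ≠ 0 := by exact_mod_cast hm.ne'
  rw [expMeasure_eq, charFun_measureOfDensity (by fun_prop) (fun x _ ↦ by positivity)]
  have h := (integral_exp_mul_exp (a := 1 / m) (by positivity) θ).1
  simp only [Complex.ofReal_mul (1 / m), mul_assoc] at h ⊢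
  rw [integral_const_mul, h]
  have h2 : (1 - ↑(θ * m) * Complex.I : ℂ) = 1 - m * (θ * Complex.I) := by push_cast; ring
  rw [h2]
  have h3 : ((1 / m : ℝ) : ℂ) - θ * Complex.I = (1 - m * (θ * Complex.I)) / m := by
    push_cast; field_simp
  rw [h3]
  push_cast
  field_simp

lemma continuous_fGamma (γ : ℕ) : Continuous (fGamma γ) := by
  unfold fGamma
  fun_prop

lemma charFun_fGamma (n : ℕ) (hn : 1 ≤ n) (θ : ℝ) :
    (∏ j ∈ Finset.Icc 1 n, (1 - j * (θ * Complex.I) : ℂ)) *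
      charFun (measureOfDensity (fGamma (n + 1))) θ = 1 := by
  refine Eq.trans ?_ (sum_hypoCoeff_div n hn θ)
  rw [charFun_measureOfDensity (continuous_fGamma _).measurable
    (fGamma_nonneg n hn)]
  congr 1
  have hterm : ∀ x : ℝ, (fGamma (n + 1) x : ℂ) * Complex.exp ((θ * Complex.I) * x) =
      ∑ i ∈ Finset.Icc 1 n, (hypoCoeff n i : ℂ) *
        (((Real.exp (-(1 / (i : ℝ) * x)) : ℝ) : ℂ) * Complex.exp ((θ * Complex.I) * x)) := by
    intro x
    rw [fGamma_eq, Complex.ofReal_sum, Finset.sum_mul]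
    refine Finset.sum_congr rfl fun i _ ↦ ?_
    rw [Complex.ofReal_mul, mul_assoc, show -x / (i : ℝ) = -(1 / (i : ℝ) * x) by ring]
  simp only [hterm]
  have hpos : ∀ i ∈ Finset.Icc 1 n, (0 : ℝ) < 1 / i := fun i hi ↦ by
    have : 0 < i := (Finset.mem_Icc.1 hi).1
    positivity
  rw [integral_finsetSum _ fun i hi ↦ (integral_exp_mul_exp (hpos i hi) θ).2.const_mul _]
  refine Finset.sum_congr rfl fun i hi ↦ ?_
  rw [integral_const_mul, (integral_exp_mul_exp (hpos i hi) θ).1]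
  congr 1
  have hi0 : (i : ℂ) ≠ 0 := by
    have : 0 < i := (Finset.mem_Icc.1 hi).1
    exact_mod_cast this.ne'
  have hne : (1 - i * (θ * Complex.I) : ℂ) ≠ 0 := by exact_mod_cast one_sub_mul_I_ne_zero i θ
  have h3 : ((1 / (i : ℝ) : ℝ) : ℂ) - θ * Complex.I = (1 - i * (θ * Complex.I)) / i := by
    push_cast; field_simp
  rw [h3, one_div_div]

lemma isFiniteMeasure_fGamma (n : ℕ) : IsFiniteMeasure (measureOfDensity (fGamma (n + 1))) := by
  refine isFiniteMeasure_measureOfDensity ?_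
  rw [integrableOn_Ici_iff_integrableOn_Ioi]
  have : fGamma (n + 1) = fun x ↦ ∑ i ∈ Finset.Icc 1 n, hypoCoeff n i * Real.exp (-x / i) :=
    funext fun x ↦ fGamma_eq n x
  rw [this]
  refine integrable_finsetSum _ fun i hi ↦ Integrable.const_mul ?_ _
  have hi0 : 0 < i := (Finset.mem_Icc.1 hi).1
  have h := integrableOn_exp_mul_Ioi (a := -(1 / (i : ℝ))) (neg_neg_of_pos (by positivity)) 0
  refine h.congr_fun (fun x _ ↦ ?_) measurableSet_Ioi
  simp only
  congr 1
  ring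

/-! ### Reduction to threshold 1. -/

section Scaling

variable (w : ℝ≥0 → ℝ) {t : ℝ}

lemma isRightPoint_div_log (ht : 1 < t) (m r : ℝ≥0) :
    IsRightPoint w t m r ↔ IsRightPoint (fun x ↦ w x / Real.log t) (Real.exp 1) m r := by
  have hL := Real.log_pos ht
  have : ∀ x, w m / Real.log t + 1 ≤ w x / Real.log t ↔ w m + Real.log t ≤ w x := fun x ↦ by
    rw [div_add_one hL.ne', div_le_div_iff_of_pos_right hL]
  simp only [IsRightPoint, Real.log_exp, this]

lemma isLeftPoint_div_log (ht : 1 < t) (m l : ℝ≥0) :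
    IsLeftPoint w t m l ↔ IsLeftPoint (fun x ↦ w x / Real.log t) (Real.exp 1) m l := by
  have hL := Real.log_pos ht
  have : ∀ x, w m / Real.log t + 1 ≤ w x / Real.log t ↔ w m + Real.log t ≤ w x := fun x ↦ by
    rw [div_add_one hL.ne', div_le_div_iff_of_pos_right hL]
  simp only [IsLeftPoint, Real.log_exp, this]

lemma isMinOn_div_log (ht : 1 < t) (s : Set ℝ≥0) (m : ℝ≥0) :
    IsMinOn (fun x ↦ w x / Real.log t) s m ↔ IsMinOn w s m := by
  simp only [isMinOn_iff, div_le_div_iff_of_pos_right (Real.log_pos ht)]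

lemma isMaxOn_div_log (ht : 1 < t) (s : Set ℝ≥0) (m : ℝ≥0) :
    IsMaxOn (fun x ↦ w x / Real.log t) s m ↔ IsMaxOn w s m := by
  simp only [isMaxOn_iff, div_le_div_iff_of_pos_right (Real.log_pos ht)]

lemma isStablePoint_div_log (ht : 1 < t) (m : ℝ≥0) :
    IsStablePoint w t m ↔ IsStablePoint (fun x ↦ w x / Real.log t) (Real.exp 1) m := by
  simp only [IsStablePoint, IsFirstStablePoint, isRightPoint_div_log w ht,
    isLeftPoint_div_log w ht, isMinOn_div_log w ht]

lemma stablePoint_div_log (ht : 1 < t) (i : ℕ) :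
    stablePoint w t i = stablePoint (fun x ↦ w x / Real.log t) (Real.exp 1) i := by
  induction i with
  | zero => simp only [stablePoint, isStablePoint_div_log w ht]
  | succ i ih => simp only [stablePoint, isStablePoint_div_log w ht, ih]

/-- An equality of predicates, so that `Classical.epsilon` picks the same peak on both sides. -/
lemma isPeak_div_log (ht : 1 < t) (i : ℕ) :
    IsPeak w t i = IsPeak (fun x ↦ w x / Real.log t) (Real.exp 1) i := by
  ext h
  simp only [IsPeak, stablePoint_div_log w ht, isMaxOn_div_log w ht]

lemma peak_div_log (ht : 1 < t) (i : ℕ) :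
    peak w t i = peak (fun x ↦ w x / Real.log t) (Real.exp 1) i := by
  rw [peak, peak, isPeak_div_log w ht]

end Scaling

lemma sum_range_two_mul {M : Type*} [AddCommMonoid M] (f : ℕ → M) (n : ℕ) :
    ∑ j ∈ Finset.range (2 * n), f j = ∑ i ∈ Finset.range n, (f (2 * i) + f (2 * i + 1)) := by
  induction n with
  | zero => simp
  | succ n ih =>
    rw [show 2 * (n + 1) = 2 * n + 1 + 1 by ring, Finset.sum_range_succ, Finset.sum_range_succ,
      Finset.sum_range_succ, ih, add_assoc]

lemma prod_range_two_mul {M : Type*} [CommMonoid M] (f : ℕ → M) (n : ℕ) :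
    ∏ j ∈ Finset.range (2 * n), f j = ∏ i ∈ Finset.range n, (f (2 * i) * f (2 * i + 1)) := by
  induction n with
  | zero => simp
  | succ n ih =>
    rw [show 2 * (n + 1) = 2 * n + 1 + 1 by ring, Finset.prod_range_succ, Finset.prod_range_succ,
      Finset.prod_range_succ, ih, mul_assoc]

/-! ### Laws and independence of the weighted gains. -/

section Brownian

variable {Ω : Type*} [MeasurableSpace Ω] {P : Measure Ω} {c : ℝ} {V : ℝ≥0 → Ω → ℝ}
  {g : ℕ → Ω → ℝ}

/-- The joint characteristic function of the gains of the rising phases. -/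
lemma IsPhaseGains.integral_exp_odd [IsProbabilityMeasure P] (hg : IsPhaseGains V g P)
    (hV : IsBrownianWithDiffusion c V P) {n : ℕ} (a : Fin n → ℝ) :
    (∏ i, (1 - a i * Complex.I : ℂ)) *
      ∫ ω, Complex.exp (((∑ i, a i * g (2 * i + 1) ω : ℝ) : ℂ) * Complex.I) ∂P = 1 := by
  let a' : ℕ → ℝ := fun i ↦ if h : i < n then a ⟨i, h⟩ else 0
  -- Frequency 0 on the even phases turns their factors into 1, and `j / 2` recovers `i` from `j = 2
  -- * i + 1`.
  let θ : ℕ → ℝ := fun j ↦ if Even j then 0 else a' (j / 2)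
  have h := hg.integral_exp hV (2 * n) θ
  have e0 : ∀ i, θ (2 * i) = 0 := fun i ↦ by simp [θ]
  have e1 : ∀ i, θ (2 * i + 1) = a' i := fun i ↦ by
    simp only [θ, Nat.not_even_two_mul_add_one, if_false]
    congr 1
    omega
  simp only [sum_range_two_mul, prod_range_two_mul, e0, e1, Complex.ofReal_zero, zero_mul, sub_zero,
    one_mul, zero_add] at h
  rw [Finset.prod_range] at h
  simpa only [Finset.sum_range, a', Fin.is_lt, dif_pos, Fin.eta] using h

/-- Multiples of the gains of the rising phases of a Brownian motion are independent and
exponentially distributed. -/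
lemma IsPhaseGains.hasLaw_exp [IsProbabilityMeasure P] (hg : IsPhaseGains V g P)
    (hV : IsBrownianWithDiffusion c V P) {n : ℕ} {m : Fin n → ℝ} (hm : ∀ i, 0 < m i) (i : Fin n) :
    HasLaw (fun ω ↦ m i * g (2 * i + 1) ω) (expMeasure (1 / m i)) P := by
  have hmeas : AEMeasurable (fun ω ↦ m i * g (2 * i + 1) ω) P := (hg.aemeasurable hV _).const_mul _
  refine ⟨hmeas, ?_⟩
  have : IsProbabilityMeasure (P.map fun ω ↦ m i * g (2 * i + 1) ω) :=
    Measure.isProbabilityMeasure_map hmeas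
  have : IsProbabilityMeasure (expMeasure (1 / m i)) :=
    isProbabilityMeasure_expMeasure (one_div_pos.2 (hm i))
  refine Measure.ext_of_charFun (funext fun θ ↦ ?_)
  rw [charFun_expMeasure (hm i), charFun_apply_real, integral_map hmeas (by fun_prop),
    eq_div_iff_mul_eq (by
      have := one_sub_mul_I_ne_zero (θ * m i) 1
      simpa using this), mul_comm]
  have h := hg.integral_exp_odd hV (fun j ↦ if j = i then θ * m i else 0)
  rw [Finset.prod_congr rfl (fun j _ ↦ show (1 - ((if j = i then θ * m i else 0 : ℝ) : ℂ) *
    Complex.I : ℂ) = if j = i then (1 - (θ * m i : ℝ) * Complex.I : ℂ) else 1 by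
      split_ifs <;> simp), Finset.prod_ite_eq'] at h
  simp only [Finset.mem_univ, if_true, ite_mul, zero_mul, Finset.sum_ite_eq'] at h
  rw [← h]
  congr 2 with ω
  push_cast
  congr 2
  ring

/-- The joint characteristic function factors into those of the marginals. -/
lemma IsPhaseGains.iIndepFun [IsProbabilityMeasure P] (hg : IsPhaseGains V g P)
    (hV : IsBrownianWithDiffusion c V P) {n : ℕ} {m : Fin n → ℝ} (hm : ∀ i, 0 < m i) :
    iIndepFun (fun (i : Fin n) ω ↦ m i * g (2 * i + 1) ω) P := by
  have hmeas : ∀ i : Fin n, AEMeasurable (fun ω ↦ m i * g (2 * i + 1) ω) P := fun i ↦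
    (hg.aemeasurable hV _).const_mul _
  rw [iIndepFun_iff_charFun_pi hmeas]
  intro t
  simp only [fun i ↦ (hg.hasLaw_exp hV hm i).map_eq, fun i ↦ charFun_expMeasure (hm i),
    Finset.prod_div_distrib, Finset.prod_const_one]
  have hne : ∏ i, (1 - (t i * m i : ℝ) * Complex.I : ℂ) ≠ 0 := by
    refine Finset.prod_ne_zero_iff.2 fun i _ ↦ ?_
    have := one_sub_mul_I_ne_zero (t i * m i) 1
    simpa using this
  rw [eq_div_iff_mul_eq hne, mul_comm, charFun_apply]
  have hmeas' : AEMeasurable (fun ω ↦ WithLp.toLp 2 fun i : Fin n ↦ m i * g (2 * i + 1) ω) P := by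
    have := aemeasurable_pi_lambda (fun ω (i : Fin n) ↦ m i * g (2 * i + 1) ω) hmeas
    fun_prop
  rw [integral_map hmeas' (by fun_prop)]
  refine Eq.trans ?_ (hg.integral_exp_odd hV (fun i ↦ t i * m i))
  congr 2 with ω
  congr 3
  rw [PiLp.inner_apply]
  refine Finset.sum_congr rfl fun i _ ↦ ?_
  simp
  ring

lemma prod_reflect (n : ℕ) (θ : ℝ) :
    ∏ i : Fin n, (1 - (θ * ((n : ℝ) - (i : ℕ)) : ℝ) * Complex.I : ℂ) =
      ∏ j ∈ Finset.Icc 1 n, (1 - j * (θ * Complex.I) : ℂ) := by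
  rw [← Finset.prod_range (fun i ↦ (1 - (θ * ((n : ℝ) - (i : ℕ)) : ℝ) * Complex.I : ℂ))]
  refine Finset.prod_nbij' (fun i ↦ n - i) (fun j ↦ n - j) ?_ ?_ ?_ ?_ ?_
  · intro i hi; simp at hi ⊢; omega
  · intro i hi; simp at hi ⊢; omega
  · intro i hi; simp at hi ⊢; omega
  · intro i hi; simp at hi ⊢; omega
  · intro i hi
    rw [Finset.mem_range] at hi
    rw [Nat.cast_sub hi.le]
    push_cast
    ring

lemma IsPhaseGains.hasLaw_sum [IsProbabilityMeasure P] (hg : IsPhaseGains V g P)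
    (hV : IsBrownianWithDiffusion c V P) {n : ℕ} (hn : 1 ≤ n) :
    HasLaw (fun ω ↦ ∑ i : Fin n, ((n : ℝ) - (i : ℕ)) * g (2 * i + 1) ω)
      (measureOfDensity (fGamma (n + 1))) P := by
  have hmeas : AEMeasurable (fun ω ↦ ∑ i : Fin n, ((n : ℝ) - (i : ℕ)) * g (2 * i + 1) ω) P :=
    Finset.aemeasurable_fun_sum _ fun i _ ↦ (hg.aemeasurable hV _).const_mul _
  refine ⟨hmeas, ?_⟩
  -- Finiteness is enough for uniqueness from characteristic functions; that the density has mass 1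
  -- comes out of the identification.
  have := isFiniteMeasure_fGamma n
  refine Measure.ext_of_charFun (funext fun θ ↦ ?_)
  have hne : ∏ j ∈ Finset.Icc 1 n, (1 - j * (θ * Complex.I) : ℂ) ≠ 0 := by
    refine Finset.prod_ne_zero_iff.2 fun j _ ↦ ?_
    exact_mod_cast one_sub_mul_I_ne_zero j θ
  refine mul_left_cancel₀ hne ?_
  rw [charFun_fGamma n hn θ, ← prod_reflect, charFun_apply_real,
    integral_map hmeas (by fun_prop)]
  refine Eq.trans ?_ (hg.integral_exp_odd hV (fun i : Fin n ↦ θ * ((n : ℝ) - (i : ℕ))))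
  congr 2 with ω
  congr 2
  push_cast
  rw [Finset.mul_sum]
  simp only [mul_assoc]

/-- The gains of the phases of a Brownian motion exist, and those of the rising phases are the
excess heights of the peaks. -/
lemma IsBrownianWithDiffusion.exists_isPhaseGains [IsProbabilityMeasure P]
    (hV : IsBrownianWithDiffusion c V P) (hc : c ≠ 0) :
    ∃ g : ℕ → Ω → ℝ, IsPhaseGains V g P ∧ ∀ᵐ ω ∂P, ∀ i,
      IsStablePoint (V · ω) (Real.exp 1) (stablePoint (V · ω) (Real.exp 1) i) ∧
      stablePoint (V · ω) (Real.exp 1) i < stablePoint (V · ω) (Real.exp 1) (i + 1) ∧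
      IsPeak (V · ω) (Real.exp 1) i (peak (V · ω) (Real.exp 1) i) ∧
      V (peak (V · ω) (Real.exp 1) i) ω - V (stablePoint (V · ω) (Real.exp 1) i) ω =
        g (2 * i + 1) ω + 1 := by
  have hex : ∀ ω, ∃ q : (ℕ → ℝ≥0) × (ℕ → ℝ≥0),
      IsGenericPath (V · ω) → IsSkeleton (V · ω) q.1 q.2 := by
    intro ω
    by_cases h : IsGenericPath (V · ω)
    · obtain ⟨τ, k, H⟩ := h.exists_isSkeleton
      exact ⟨(τ, k), fun _ ↦ H⟩
    -- Paths that are not generic form a null set, so any value will do there.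
    · exact ⟨default, fun h' ↦ absurd h' h⟩
  choose q hq using hex
  refine ⟨fun j ω ↦ phaseSign j * (V ((q ω).2 j) ω - V ((q ω).1 j) ω), ?_, ?_⟩
  · filter_upwards [hV.ae_isGenericPath hc] with ω hω
    exact ⟨hω, _, _, hq ω hω, fun j ↦ rfl⟩
  · filter_upwards [hV.ae_isGenericPath hc] with ω hω i
    have H := hq ω hω
    refine ⟨?_, ?_, H.isPeak_peak hω i, ?_⟩
    · rw [H.stablePoint_eq hω]
      exact H.isStablePoint_even hω i
    · rw [H.stablePoint_eq hω, H.stablePoint_eq hω]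
      exact H.strictMono (by omega)
    · have := H.peak_sub_stablePoint hω i
      linarith

end Brownian

/-! ### Conclusion. -/

lemma sum_sub_succ (n : ℕ) (a : ℝ) :
    ∑ i ∈ Finset.range n, (a - ((i : ℝ) + 1)) = n * a - n * (n + 1) / 2 := by
  induction n with
  | zero => simp
  | succ n ih => rw [Finset.sum_range_succ, ih]; push_cast; ring

theorem theorem2 {Ω : Type*} [MeasurableSpace Ω] (P : Measure Ω) [IsProbabilityMeasure P]
    (σ : ℝ) (hσ : 0 < σ) (W : ℝ≥0 → Ω → ℝ) (hW : IsBrownianWithDiffusion σ W P)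
    (γ : ℕ) (hγ : 2 ≤ γ) :
    -- for each `t > 1`, the points entering the definition of `ζ_γ(t)` exist almost surely
    (∀ t : ℝ, 1 < t → ∀ᵐ ω ∂P,
      (∀ i < γ, IsStablePoint (W · ω) t (stablePoint (W · ω) t i)) ∧
      (∀ i < γ - 1, stablePoint (W · ω) t i < stablePoint (W · ω) t (i + 1) ∧
        IsPeak (W · ω) t i (peak (W · ω) t i))) ∧
    -- the law of `ζ_γ(t)` does not depend on `t`
    (∀ s t : ℝ, 1 < s → 1 < t →
      IdentDistrib (fun ω ↦ zeta γ (W · ω) s) (fun ω ↦ zeta γ (W · ω) t) P P) ∧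
    -- `ζ_γ(t) - γ(γ-1)/2` has density `f_γ` on `[0, ∞)`
    (∀ x : ℝ, 0 ≤ x → 0 ≤ fGamma γ x) ∧
    (∀ t : ℝ, 1 < t →
      HasLaw (fun ω ↦ zeta γ (W · ω) t - (γ : ℝ) * ((γ : ℝ) - 1) / 2)
        (volume.withDensity fun x : ℝ ↦ if 0 ≤ x then ENNReal.ofReal (fGamma γ x) else 0) P) ∧
    -- it is the sum of independent exponential variables with means `γ - 1, …, 1`
    (∀ t : ℝ, 1 < t → ∃ E : Fin (γ - 1) → Ω → ℝ,
      iIndepFun E P ∧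
      (∀ i : Fin (γ - 1), HasLaw (E i) (expMeasure (1 / ((γ : ℝ) - ((i : ℕ) + 1)))) P) ∧
      ∀ᵐ ω ∂P, zeta γ (W · ω) t - (γ : ℝ) * ((γ : ℝ) - 1) / 2 = ∑ i, E i ω) := by
  obtain ⟨n, rfl⟩ : ∃ n, γ = n + 1 := ⟨γ - 1, by omega⟩
  have hn : 1 ≤ n := by omega
  -- After this rescaling `t` survives only in the diffusion constant, on which the laws of the
  -- gains do not depend.
  have hV : ∀ t : ℝ, IsBrownianWithDiffusion (σ / Real.log t) (fun x ω ↦ W x ω / Real.log t) P :=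
    fun t ↦ hW.div_const _
  have hgains : ∀ t : ℝ, 1 < t → ∃ g : ℕ → Ω → ℝ,
      IsPhaseGains (fun x ω ↦ W x ω / Real.log t) g P ∧ ∀ᵐ ω ∂P, ∀ i,
      IsStablePoint (W · ω) t (stablePoint (W · ω) t i) ∧
      stablePoint (W · ω) t i < stablePoint (W · ω) t (i + 1) ∧
      IsPeak (W · ω) t i (peak (W · ω) t i) ∧
      (W (peak (W · ω) t i) ω - W (stablePoint (W · ω) t i) ω) / Real.log t =
        g (2 * i + 1) ω + 1 := by
    intro t ht
    obtain ⟨g, hg, hg'⟩ := (hV t).exists_isPhaseGains (div_pos hσ (Real.log_pos ht)).ne'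
    refine ⟨g, hg, ?_⟩
    filter_upwards [hg'] with ω hω i
    simp only [sub_div, isStablePoint_div_log (W · ω) ht, stablePoint_div_log (W · ω) ht,
      isPeak_div_log (W · ω) ht, peak_div_log (W · ω) ht]
    exact hω i
  have hsum : ∀ (t : ℝ) (g : ℕ → Ω → ℝ) (ω : Ω), (∀ i,
      (W (peak (W · ω) t i) ω - W (stablePoint (W · ω) t i) ω) / Real.log t =
        g (2 * i + 1) ω + 1) →
      zeta (n + 1) (W · ω) t - ((n + 1 : ℕ) : ℝ) * (((n + 1 : ℕ) : ℝ) - 1) / 2 =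
        ∑ i : Fin n, ((n : ℝ) - (i : ℕ)) * g (2 * i + 1) ω := by
    intro t g ω hω
    rw [zeta, Nat.add_sub_cancel,
      ← Finset.sum_range (fun i ↦ ((n : ℝ) - (i : ℕ)) * g (2 * i + 1) ω)]
    -- Each normalized height is a gain plus 1; the weights of the ones add up to `γ (γ - 1) / 2`,
    -- with `γ = n + 1`.
    simp only [hω, mul_add, mul_one, Finset.sum_add_distrib]
    rw [sum_sub_succ]
    push_cast
    have : ∀ i : ℕ, (n : ℝ) + 1 - (i + 1) = n - i := fun i ↦ by ring
    simp only [this]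
    ring
  have hlaw : ∀ t : ℝ, 1 < t →
      HasLaw (fun ω ↦ zeta (n + 1) (W · ω) t - ((n + 1 : ℕ) : ℝ) * (((n + 1 : ℕ) : ℝ) - 1) / 2)
        (measureOfDensity (fGamma (n + 1))) P := by
    intro t ht
    obtain ⟨g, hg, hg'⟩ := hgains t ht
    refine (hg.hasLaw_sum (hV t) hn).congr ?_
    filter_upwards [hg'] with ω hω
    exact hsum t g ω fun i ↦ (hω i).2.2.2
  refine ⟨fun t ht ↦ ?_, fun s t hs ht ↦ ?_, fGamma_nonneg n hn, hlaw, fun t ht ↦ ?_⟩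
  · obtain ⟨g, -, hg'⟩ := hgains t ht
    filter_upwards [hg'] with ω hω
    exact ⟨fun i _ ↦ (hω i).1, fun i _ ↦ ⟨(hω i).2.1, (hω i).2.2.1⟩⟩
  · have hid : IdentDistrib
        (fun ω ↦ zeta (n + 1) (W · ω) s - ((n + 1 : ℕ) : ℝ) * (((n + 1 : ℕ) : ℝ) - 1) / 2)
        (fun ω ↦ zeta (n + 1) (W · ω) t - ((n + 1 : ℕ) : ℝ) * (((n + 1 : ℕ) : ℝ) - 1) / 2) P P :=
      ⟨(hlaw s hs).aemeasurable, (hlaw t ht).aemeasurable,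
        (hlaw s hs).map_eq.trans (hlaw t ht).map_eq.symm⟩
    have := hid.comp (measurable_add_const (((n + 1 : ℕ) : ℝ) * (((n + 1 : ℕ) : ℝ) - 1) / 2))
    simpa only [Function.comp_def, sub_add_cancel] using this
  · obtain ⟨g, hg, hg'⟩ := hgains t ht
    have hm : ∀ i : Fin n, 0 < (n : ℝ) - (i : ℕ) := fun i ↦ by
      rw [sub_pos]; exact_mod_cast i.2
    refine ⟨fun i ω ↦ ((n : ℝ) - (i : ℕ)) * g (2 * i + 1) ω, hg.iIndepFun (hV t) hm,
      fun i ↦ ?_, ?_⟩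
    · have := hg.hasLaw_exp (hV t) hm i
      rwa [show ((n + 1 : ℕ) : ℝ) - ((i : ℕ) + 1) = n - (i : ℕ) by push_cast; ring]
    · filter_upwards [hg'] with ω hω
      exact hsum t g ω fun i ↦ (hω i).2.2.2
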